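/- Let $G$ be a non-empty finite or countable directed graph (countably many vertices and edges; loops and multiple edges are allowed). Let $\mathbb F^+(G)$ be the set of all finite directed paths in $G$, including the vertices as paths of length $0$, and let $\mathcal H_G=\ell^2(\mathbb F^+(G))$ with orthonormal basis $\{\xi_w\}$. For an edge $e$ put $L_e\xi_w=\xi_{ew}$ if $ew$ (first $w$, then $e$) is a path, and $L_e\xi_w=0$ otherwise; for a vertex $x$ put $L_x\xi_w=\xi_w$ if the final vertex of $w$ is $x$, and $L_x\xi_w=0$ otherwise. Let $\mathfrak L_G$ be the closure in the weak operator topology (WOT) of the algebra generated by all $L_e$ and $L_x$, and let $\mathfrak L_2$ be this algebra for the graph with one vertex and two distinct loop edges. The saturation $\operatorname{sat}(x)$ of a vertex $x$ consists of $x$, all finite and infinite directed paths that start at $x$, and all final vertices of finite paths that start at $x$. An infinite path $e_1,e_2,\dots$ is aperiodic if it is not eventually periodic, i.e. there are no $N$ and $p\ge 1$ with $e_{n+p}=e_n$ for all $n\ge N$. A WOT-closed operator algebra $\mathfrak A$ is unitally partly free if there is a unital inclusion map $\mathfrak L_2\hookrightarrow\mathfrak A$ which is the restriction of an injective normal $*$-homomorphism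 between the von Neumann algebras generated by $\mathfrak L_2$ and by $\mathfrak A$. **Theorem.** The following assertions are equivalent: (i) $G$ has the uniform aperiodic path property: for every vertex $x$, $\operatorname{sat}(x)$ contains an aperiodic infinite path. (ii) $\mathfrak L_G$ is unitally partly free. (iii) There are isometries $U,V\in\mathfrak L_G$ with $U^*V=0$. -/

import Mathlib

open Filter Topology

universe u v

noncomputable section

/-! ### Paths in a directed graph

A directed graph (loops and multiple edges allowed) is a `Quiver V`; its edges are the elements of
`Quiver.Total V`. In `Quiver.Path a b`, the path `p.cons e` is `p` followed by the edge `e`, that is,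
the word `e p` in the convention where words are read from right to left. -/

/-- The free semigroupoid of the graph: all finite paths, where the paths of length zero are the
vertices. The path `⟨x, y, w⟩` has initial vertex `x` and final vertex `y`. -/
abbrev FreeSemigroupoid (V : Type u) [Quiver.{v} V] : Type (max u v) :=
  Σ a b : V, Quiver.Path a b

/-- Infinite directed paths, as infinite sequences of consecutive edges. -/
structure InfinitePath (V : Type u) [Quiver.{v} V] where
  edge : ℕ → Quiver.Total V
  consecutive : ∀ n, (edge n).right = (edge (n + 1)).left

namespace InfinitePath

variable {V : Type u} [Quiver.{v} V]

/-- The initial vertex of an infinite path. -/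
def source (ω : InfinitePath V) : V := (ω.edge 0).left

/-- The path becomes periodic: from some point on its edges repeat with a period `p ≥ 1`. -/
def EventuallyPeriodic (ω : InfinitePath V) : Prop :=
  ∃ N p : ℕ, 0 < p ∧ ∀ n, N ≤ n → ω.edge (n + p) = ω.edge n

/-- An infinite path is aperiodic if it does not become periodic. -/
def Aperiodic (ω : InfinitePath V) : Prop := ¬ ω.EventuallyPeriodic

end InfinitePath

/-- The saturation of a vertex `x`: the final vertices of the finite paths that start at `x`
(among them `x` itself), together with all the finite and all the infinite paths that start
at `x`. -/
def saturation {V : Type u} [Quiver.{v} V] (x : V) :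
    Set (V ⊕ (FreeSemigroupoid V ⊕ InfinitePath V)) :=
  {s | match s with
    | .inl y => Nonempty (Quiver.Path x y)
    | .inr (.inl w) => w.1 = x
    | .inr (.inr ω) => ω.source = x}

/-- The saturation at every vertex contains an aperiodic infinite path. -/
def UniformAperiodicPathProperty (V : Type u) [Quiver.{v} V] : Prop :=
  ∀ x : V, ∃ ω : InfinitePath V, .inr (.inr ω) ∈ saturation x ∧ ω.Aperiodic

/-! ### The left regular representation on the Fock space -/

/-- The Hilbert space `ℓ²` of the set of finite paths. -/
abbrev FockSpace (V : Type u) [Quiver.{v} V] : Type (max u v) :=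
  lp (fun _ : FreeSemigroupoid V => ℂ) 2

open Classical in
/-- The orthonormal basis vector `ξ_w` of the Fock space. -/
def fockBasis {V : Type u} [Quiver.{v} V] (w : FreeSemigroupoid V) : FockSpace V :=
  lp.single 2 w (1 : ℂ)

section PartialShift

variable {X : Type u}

theorem summable_option_elim (g : X → Option X)
    (hg : ∀ a b c, g a = some c → g b = some c → a = b) (f : X → ℝ) (hf : Summable f)
    (h0 : ∀ x, 0 ≤ f x) :
    Summable (fun a => (g a).elim 0 f) ∧ ∑' a, (g a).elim 0 f ≤ ∑' a, f a := by
  have key : ∀ s : Finset X, ∑ a ∈ s, (g a).elim 0 f ≤ ∑' a, f a := by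
    classical
    intro s
    have h1 : ∑ a ∈ s, (g a).elim 0 f
        ≤ ∑ b ∈ s.biUnion (fun a => (g a).toFinset), f b := by
      rw [Finset.sum_biUnion]
      · apply le_of_eq
        apply Finset.sum_congr rfl
        intro a _
        cases g a <;> simp
      · intro a _ b _ hab
        rw [Function.onFun, Finset.disjoint_left]
        intro c hc hc'
        rw [Option.mem_toFinset] at hc hc'
        exact hab (hg a b c hc hc')
    exact h1.trans (hf.sum_le_tsum _ (fun x _ => h0 x))
  have hnn : ∀ a, 0 ≤ (g a).elim 0 f := by
    intro a
    cases g a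
    · simp
    · simpa using h0 _
  have hs := summable_of_sum_le hnn key
  exact ⟨hs, hs.tsum_le_of_sum_le key⟩

theorem norm_option_elim_sq (o : Option X) (φ : X → ℂ) :
    ‖o.elim 0 φ‖ ^ (2 : ENNReal).toReal
      = o.elim 0 (fun x => ‖φ x‖ ^ (2 : ENNReal).toReal) := by
  cases o <;> simp

/-- For a partially defined map `g` on `X` which is injective on its domain, the contraction on
`ℓ²(X)` with `(T φ)(a) = φ (g a)` if `g a` is defined, and `0` otherwise. It maps the basis vector
at `g a` to the basis vector at `a`, and the basis vectors outside the range of `g` to `0`. -/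
def partialShift (g : X → Option X) (hg : ∀ a b c, g a = some c → g b = some c → a = b) :
    lp (fun _ : X => ℂ) 2 →L[ℂ] lp (fun _ : X => ℂ) 2 :=
  LinearMap.mkContinuous
    { toFun := fun φ => ⟨fun a => (g a).elim 0 φ, by
        apply memℓp_gen
        simp only [norm_option_elim_sq]
        exact (summable_option_elim g hg _ ((lp.memℓp φ).summable (by norm_num))
          (fun x => by positivity)).1⟩
      map_add' := by
        intro φ ψ
        ext a
        change (g a).elim 0 (φ + ψ : lp (fun _ : X => ℂ) 2) = (g a).elim 0 φ + (g a).elim 0 ψ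
        cases g a with
        | none => exact (add_zero (0 : ℂ)).symm
        | some b => rfl
      map_smul' := by
        intro c φ
        ext a
        change (g a).elim 0 (c • φ : lp (fun _ : X => ℂ) 2) = c • (g a).elim 0 φ
        cases g a with
        | none => simp
        | some b => rfl } 1 (by
    intro φ
    rw [one_mul]
    have h2 : (0 : ℝ) < (2 : ENNReal).toReal := by norm_num
    rw [← Real.rpow_le_rpow_iff (norm_nonneg _) (norm_nonneg _) h2,
      lp.norm_rpow_eq_tsum h2, lp.norm_rpow_eq_tsum h2]
    simp only [LinearMap.coe_mk, AddHom.coe_mk, norm_option_elim_sq]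
    exact (summable_option_elim g hg _ ((lp.memℓp φ).summable (by norm_num))
      (fun x => by positivity)).2)

@[simp]
theorem partialShift_apply (g : X → Option X)
    (hg : ∀ a b c, g a = some c → g b = some c → a = b) (φ : lp (fun _ : X => ℂ) 2) (a : X) :
    partialShift g hg φ a = (g a).elim 0 φ := rfl

end PartialShift

section LeftRegular

variable {V : Type u} [Quiver.{v} V]

open Classical in
/-- Removal of the last edge from a finite path, if this edge is `e`: it sends `e w` to `w` and is
undefined at the other paths. -/
def removeLastEdge (e : Quiver.Total V) : FreeSemigroupoid V → Option (FreeSemigroupoid V)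
  | ⟨_, _, .nil⟩ => none
  | ⟨a, c, .cons (b := b) p e'⟩ => if (⟨b, c, e'⟩ : Quiver.Total V) = e then some ⟨a, b, p⟩ else none

theorem removeLastEdge_eq_some {e : Quiver.Total V} {w w' : FreeSemigroupoid V}
    (h : removeLastEdge e w = some w') :
    ∃ (a b c : V) (p : Quiver.Path a b) (e' : b ⟶ c),
      w = ⟨a, c, p.cons e'⟩ ∧ w' = ⟨a, b, p⟩ ∧ e = ⟨b, c, e'⟩ := by
  obtain ⟨a, c, p⟩ := w
  cases p with
  | nil => simp [removeLastEdge] at h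
  | cons p e' =>
    simp only [removeLastEdge] at h
    split_ifs at h with he
    exact ⟨_, _, _, p, e', rfl, (Option.some.inj h).symm, he.symm⟩

theorem removeLastEdge_injective (e : Quiver.Total V) (w₁ w₂ w : FreeSemigroupoid V)
    (h₁ : removeLastEdge e w₁ = some w) (h₂ : removeLastEdge e w₂ = some w) : w₁ = w₂ := by
  obtain ⟨a, b, c, p, e₁, rfl, rfl, rfl⟩ := removeLastEdge_eq_some h₁
  obtain ⟨a', b', c', p', e₂, rfl, h, h'⟩ := removeLastEdge_eq_some h₂
  cases h
  cases h'
  rfl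

/-- The operator `L_e` of an edge `e`: it maps `ξ_w` to `ξ_{ew}` if `e w` is a path, and to `0`
otherwise. -/
def leftEdge (e : Quiver.Total V) : FockSpace V →L[ℂ] FockSpace V :=
  partialShift (removeLastEdge e) (removeLastEdge_injective e)

open Classical in
/-- The projection `L_x` of a vertex `x`: it maps `ξ_w` to `ξ_w` if the final vertex of `w` is `x`,
and to `0` otherwise. -/
def leftVertex (x : V) : FockSpace V →L[ℂ] FockSpace V :=
  partialShift (fun w => if w.2.1 = x then some w else none) (by
    intro a b c ha hb
    split_ifs at ha hb
    exact (Option.some.inj ha).trans (Option.some.inj hb).symm)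

theorem leftEdge_fockBasis {a b c : V} (p : Quiver.Path a b) (e : b ⟶ c) :
    leftEdge ⟨b, c, e⟩ (fockBasis ⟨a, b, p⟩) = fockBasis ⟨a, c, p.cons e⟩ := by
  classical
  ext w
  rw [leftEdge, partialShift_apply]
  by_cases hw : w = ⟨a, c, p.cons e⟩
  · subst hw
    simp [removeLastEdge, fockBasis]
  · rw [fockBasis, fockBasis, lp.coeFn_single, lp.coeFn_single, Pi.single_eq_of_ne hw]
    rcases h : removeLastEdge ⟨b, c, e⟩ w with _ | w'
    · rfl
    · have : w' ≠ ⟨a, b, p⟩ := by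
        rintro rfl
        exact hw (removeLastEdge_injective ⟨b, c, e⟩ _ _ _ h (by simp [removeLastEdge]))
      simp [Pi.single_eq_of_ne this]

theorem leftEdge_fockBasis_of_ne (e : Quiver.Total V) (w : FreeSemigroupoid V)
    (hw : w.2.1 ≠ e.left) : leftEdge e (fockBasis w) = 0 := by
  classical
  ext u
  rw [leftEdge, partialShift_apply, fockBasis, lp.coeFn_single]
  rcases h : removeLastEdge e u with _ | w'
  · rfl
  · have : w' ≠ w := by
      rintro rfl
      obtain ⟨a, b, c, p, e', -, rfl, rfl⟩ := removeLastEdge_eq_some h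
      exact hw rfl
    simp [Pi.single_eq_of_ne this]

theorem leftVertex_fockBasis (x : V) (w : FreeSemigroupoid V) (hw : w.2.1 = x) :
    leftVertex x (fockBasis w) = fockBasis w := by
  classical
  ext u
  rw [leftVertex, partialShift_apply, fockBasis, lp.coeFn_single]
  split_ifs with h
  · rfl
  · have : u ≠ w := by
      rintro rfl
      exact h hw
    simp [Pi.single_eq_of_ne this]

theorem leftVertex_fockBasis_of_ne (x : V) (w : FreeSemigroupoid V) (hw : w.2.1 ≠ x) :
    leftVertex x (fockBasis w) = 0 := by
  classical
  ext u
  rw [leftVertex, partialShift_apply, fockBasis, lp.coeFn_single]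
  split_ifs with h
  · have : u ≠ w := by
      rintro rfl
      exact hw h
    simp [Pi.single_eq_of_ne this]
  · rfl

end LeftRegular

section WOTClosure

variable {H : Type u} [NormedAddCommGroup H] [InnerProductSpace ℂ H]

/-- The closure of an algebra of operators in the weak operator topology. -/
def wotClosure (A : NonUnitalSubalgebra ℂ (H →L[ℂ] H)) : NonUnitalSubalgebra ℂ (H →L[ℂ] H) where
  carrier := {T | ContinuousLinearMapWOT.ofCLM T ∈
    closure (ContinuousLinearMapWOT.ofCLM '' (A : Set (H →L[ℂ] H)))}
  zero_mem' := subset_closure ⟨0, zero_mem A, rfl⟩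
  add_mem' := by
    intro S T hS hT
    refine map_mem_closure₂ continuous_add hS hT ?_
    rintro _ ⟨a, ha, rfl⟩ _ ⟨b, hb, rfl⟩
    exact ⟨a + b, add_mem ha hb, rfl⟩
  mul_mem' := by
    intro S T hS hT
    have h1 : ∀ a ∈ A, ContinuousLinearMapWOT.ofCLM a * ContinuousLinearMapWOT.ofCLM T ∈
        closure (ContinuousLinearMapWOT.ofCLM '' (A : Set (H →L[ℂ] H))) := by
      intro a ha
      refine map_mem_closure (continuous_const_mul (ContinuousLinearMapWOT.ofCLM a)) hT ?_
      rintro _ ⟨b, hb, rfl⟩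
      exact ⟨a * b, mul_mem ha hb, rfl⟩
    have h2 := map_mem_closure (continuous_mul_const (ContinuousLinearMapWOT.ofCLM T)) hS
      (t := closure (ContinuousLinearMapWOT.ofCLM '' (A : Set (H →L[ℂ] H)))) (by
        rintro _ ⟨a, ha, rfl⟩
        exact h1 a ha)
    rwa [closure_closure] at h2
  smul_mem' := by
    intro c T hT
    refine map_mem_closure (f := fun X : H →WOT[ℂ] H => c • X) (continuous_const_smul c)
      (show ContinuousLinearMapWOT.ofCLM T ∈ _ from hT) ?_
    rintro _ ⟨a, ha, rfl⟩
    exact ⟨c • a, A.smul_mem' c ha, rfl⟩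

theorem mem_wotClosure {A : NonUnitalSubalgebra ℂ (H →L[ℂ] H)} {T : H →L[ℂ] H} :
    T ∈ wotClosure A ↔ ContinuousLinearMapWOT.ofCLM T ∈
      closure (ContinuousLinearMapWOT.ofCLM '' (A : Set (H →L[ℂ] H))) := Iff.rfl

end WOTClosure

/-- The free semigroupoid algebra of a directed graph: the closure, in the weak operator topology,
of the algebra generated by all the `L_e` and `L_x`. -/
def freeSemigroupoidAlgebra (V : Type u) [Quiver.{v} V] :
    NonUnitalSubalgebra ℂ (FockSpace V →L[ℂ] FockSpace V) :=
  wotClosure (NonUnitalAlgebra.adjoin ℂ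
    (Set.range (leftEdge (V := V)) ∪ Set.range (leftVertex (V := V))))

/-- The free semigroup algebra on two generators: the algebra of the graph with a single vertex and
two distinct loop edges. -/
abbrev freeSemigroupAlgebraTwo :
    NonUnitalSubalgebra ℂ (FockSpace (Quiver.SingleObj (Fin 2)) →L[ℂ]
      FockSpace (Quiver.SingleObj (Fin 2))) :=
  freeSemigroupoidAlgebra (Quiver.SingleObj (Fin 2))

/-! ### Partly free algebras -/

section PartlyFree

variable {H : Type u} [NormedAddCommGroup H] [InnerProductSpace ℂ H] [CompleteSpace H]
variable {K : Type v} [NormedAddCommGroup K] [InnerProductSpace ℂ K] [CompleteSpace K]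

/-- The von Neumann algebra generated by a set `S` of operators: the double commutant of `S ∪ S*`
(`StarSubalgebra.centralizer ℂ S` is the commutant of `S ∪ S*`). -/
def generatedVonNeumannAlgebra (S : Set (H →L[ℂ] H)) : VonNeumannAlgebra H where
  toStarSubalgebra := StarSubalgebra.centralizer ℂ (StarSubalgebra.centralizer ℂ S : Set (H →L[ℂ] H))
  centralizer_centralizer' := by
    simp

theorem subset_generatedVonNeumannAlgebra (S : Set (H →L[ℂ] H)) :
    S ⊆ (generatedVonNeumannAlgebra S : Set (H →L[ℂ] H)) := by
  intro a ha
  change a ∈ StarSubalgebra.centralizer ℂ (StarSubalgebra.centralizer ℂ S : Set (H →L[ℂ] H))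
  rw [StarSubalgebra.mem_centralizer_iff]
  intro g hg
  have hg' := (StarSubalgebra.mem_centralizer_iff ℂ).1 hg a ha
  refine ⟨hg'.1.symm, ?_⟩
  have := congrArg star hg'.2
  simpa using this

theorem generatedVonNeumannAlgebra_le {S : Set (H →L[ℂ] H)} {M : VonNeumannAlgebra H}
    (h : S ⊆ (M : Set (H →L[ℂ] H))) : generatedVonNeumannAlgebra S ≤ M := by
  intro a ha
  rw [← SetLike.mem_coe, ← M.centralizer_centralizer]
  intro g hg
  refine ((StarSubalgebra.mem_centralizer_iff ℂ).1 ha g ?_).1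
  rw [SetLike.mem_coe, StarSubalgebra.mem_centralizer_iff]
  exact fun s hs => ⟨hg s (h hs), hg _ (star_mem (h hs))⟩

/-- A `*`-homomorphism between von Neumann algebras is normal if it is continuous for the weak
operator topologies on bounded sets: the images of a bounded net which converges in the weak operator
topology converge in the weak operator topology. (This is the same as continuity for the ultraweak
topologies.) -/
def IsNormalHom {M : VonNeumannAlgebra H} {N : VonNeumannAlgebra K}
    (Φ : M.toStarSubalgebra →⋆ₐ[ℂ] N.toStarSubalgebra) : Prop :=
  ∀ (r : ℝ) (l : Filter M.toStarSubalgebra) (T : M.toStarSubalgebra), (∀ᶠ S in l, ‖S‖ ≤ r) →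
    Tendsto (fun S => ContinuousLinearMapWOT.ofCLM (S.1 : H →L[ℂ] H)) l
      (𝓝 (ContinuousLinearMapWOT.ofCLM (T.1 : H →L[ℂ] H))) →
    Tendsto (fun S => ContinuousLinearMapWOT.ofCLM ((Φ S).1 : K →L[ℂ] K)) l
      (𝓝 (ContinuousLinearMapWOT.ofCLM ((Φ T).1 : K →L[ℂ] K)))

/-- A WOT-closed algebra `A` is unitally partly free if there is a unital inclusion map of the free
semigroup algebra on two generators into `A` which is the restriction of an injection (an injective
normal `*`-homomorphism) between the generated von Neumann algebras. -/
def UnitallyPartlyFree (A : NonUnitalSubalgebra ℂ (H →L[ℂ] H)) : Prop :=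
  ∃ Φ : (generatedVonNeumannAlgebra (freeSemigroupAlgebraTwo : Set _)).toStarSubalgebra →⋆ₐ[ℂ]
      (generatedVonNeumannAlgebra (A : Set (H →L[ℂ] H))).toStarSubalgebra,
    Function.Injective Φ ∧ IsNormalHom Φ ∧
    ∀ T, T.1 ∈ freeSemigroupAlgebraTwo → (Φ T).1 ∈ A

end PartlyFree

end

/-! From aperiodic paths to partial freeness: paths q(x,0), q(x,1) of positive length are attached
to each vertex x so that no one of them is a final segment of another
(`UniformAperiodicPathProperty.exists_code`). Following a path that ends at x by q(x,i) gives two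
injections of the set of finite paths with disjoint ranges. Both lengthen paths, so every path
arises uniquely by applying a word in the two injections to a path outside their ranges. Hence the
Fock space is a direct sum of copies of the Fock space of the two-loop graph, on which the shifts by
q(.,i) act as the amplification of the generators of `freeSemigroupAlgebraTwo`. Amplification is an
injective normal `*`-homomorphism. It need not be WOT-continuous when there are infinitely many
copies, but on the free semigroup algebra it is a compression T ↦ I* T I: right translations by the
words "n times 0, then 1" have orthogonal ranges and commute with that algebra, so the whole sum
embeds into one copy (`IsHilbertSum.amplify_mem_wotClosure`).

From partial freeness to isometries: the relations between the two generators are preserved by a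
unital `*`-homomorphism.

From isometries to aperiodic paths: if some vertex starts no aperiodic path, it reaches a vertex y
from which there is either only the trivial path or exactly one path w_n of each length n, with
finitely many final vertices (`exists_terminal_vertex`, `IsDeterministic.path_dichotomy`). Elements
of the algebra commute with right translations, so S ξ_{w_j} is a translate of S applied to the
final vertex of w_j. With finitely many final vertices, most of its weight lies within a uniform
distance M of w_j. Two isometries with orthogonal ranges would then place about 2k orthonormal
vectors almost entirely in k + M coordinates, against Bessel's inequality. -/

noncomputable section

/-! ### Edge lists of paths -/

namespace Quiver.Path

variable {V : Type u} [Quiver.{v} V]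

/-- The edges of a path, in the order in which the path runs through them. -/
def edgeList {a : V} : ∀ {b : V}, Path a b → List (Total V)
  | _, nil => []
  | _, cons (b := b) (c := c) p e => p.edgeList ++ [⟨b, c, e⟩]

@[simp]
theorem edgeList_nil (a : V) : (nil : Path a a).edgeList = [] := rfl

@[simp]
theorem edgeList_cons {a b c : V} (p : Path a b) (e : b ⟶ c) :
    (p.cons e).edgeList = p.edgeList ++ [⟨b, c, e⟩] := rfl

@[simp]
theorem length_edgeList {a b : V} (p : Path a b) : p.edgeList.length = p.length := by
  induction p with
  | nil => rfl
  | cons p e ih => simp [ih]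

@[simp]
theorem edgeList_comp {a b c : V} (p : Path a b) (q : Path b c) :
    (p.comp q).edgeList = p.edgeList ++ q.edgeList := by
  induction q with
  | nil => simp
  | cons q e ih => simp [ih]

theorem sigma_eq_of_edgeList_eq {a b c : V} (p : Path a b) (q : Path a c)
    (h : p.edgeList = q.edgeList) : (⟨b, p⟩ : Σ b, Path a b) = ⟨c, q⟩ := by
  induction p generalizing c with
  | nil =>
    cases q with
    | nil => rfl
    | cons q e => simp at h
  | cons p e ih =>
    cases q with
    | nil => simp at h
    | cons q f =>
      simp only [edgeList_cons] at h
      obtain ⟨h₁, h₂⟩ := List.append_inj' h rfl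
      cases ih q h₁
      simp only [List.cons.injEq, Total.mk.injEq, and_true, true_and] at h₂
      obtain ⟨rfl, h₂⟩ := h₂
      cases h₂
      rfl

theorem edgeList_injective {a b : V} : Function.Injective (edgeList : Path a b → List (Total V)) := by
  intro p q h
  cases sigma_eq_of_edgeList_eq p q h
  rfl

theorem left_edgeList_zero {a b : V} (p : Path a b) (h : 0 < p.edgeList.length) :
    (p.edgeList[0]).left = a := by
  induction p with
  | nil => simp at h
  | cons p e ih =>
    cases p with
    | nil => rfl
    | cons p f =>
      simp only [edgeList_cons] at ih ⊢
      rw [List.getElem_append_left (by simp)]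
      exact ih (by simp)

theorem right_edgeList_last {a b : V} (p : Path a b) (i : ℕ) (h : i < p.edgeList.length)
    (hi : i + 1 = p.length) : (p.edgeList[i]).right = b := by
  cases p with
  | nil => simp at hi
  | cons p e =>
    have : i = p.edgeList.length := by simpa using hi
    subst this
    simp

theorem right_edgeList_eq_left {a b : V} (p : Path a b) (i : ℕ) (h : i + 1 < p.edgeList.length) :
    (p.edgeList[i]).right = (p.edgeList[i + 1]).left := by
  induction p with
  | nil => simp at h
  | cons p e ih =>
    simp only [edgeList_cons, List.length_append, List.length_singleton, add_lt_add_iff_right] at h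
    simp only [edgeList_cons]
    rw [List.getElem_append_left h]
    rcases Nat.lt_or_ge (i + 1) p.edgeList.length with h' | h'
    · rw [List.getElem_append_left h']
      exact ih h'
    · rw [List.getElem_append_right h', right_edgeList_last p i h (by
        have := p.length_edgeList; omega)]
      simp

instance countable_path [Countable V] [∀ a b : V, Countable (a ⟶ b)] (a b : V) :
    Countable (Path a b) := by
  have : Countable (Total V) := by
    refine Function.Injective.countable
      (f := fun e : Total V => (⟨e.left, e.right, e.hom⟩ : Σ a b : V, a ⟶ b)) ?_
    rintro ⟨a, b, e⟩ ⟨a', b', e'⟩ h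
    cases h
    rfl
  exact edgeList_injective.countable

end Quiver.Path

open Quiver

variable {V : Type u} [Quiver.{v} V]

/-! ### Aperiodic paths and pairs of cycles -/

/-- There are two distinct closed paths at `y` of the same length. -/
def HasDistinctCycles (y : V) : Prop :=
  ∃ c d : Path y y, c.length = d.length ∧ c ≠ d

namespace InfinitePath

/-- The vertices through which an infinite path runs. -/
def vertex (ω : InfinitePath V) (n : ℕ) : V := (ω.edge n).left

theorem exists_segment (ω : InfinitePath V) (n k : ℕ) {a b : V} (ha : ω.vertex n = a)
    (hb : ω.vertex (n + k) = b) :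
    ∃ p : Path a b, p.edgeList = (List.range k).map fun i => ω.edge (n + i) := by
  induction k generalizing b with
  | zero =>
    obtain rfl : a = b := ha.symm.trans hb
    exact ⟨.nil, rfl⟩
  | succ k ih =>
    obtain ⟨p, hp⟩ := ih rfl
    obtain rfl : (ω.edge (n + k)).right = b := (ω.consecutive (n + k)).trans hb
    exact ⟨p.cons (ω.edge (n + k)).hom, by
      rw [List.range_succ, List.map_append, ← hp]; rfl⟩

/-- The path that runs first through the edge `e` and then through `ω`. -/
def cons (e : Total V) (ω : InfinitePath V) (h : e.right = ω.source) : InfinitePath V where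
  edge
    | 0 => e
    | n + 1 => ω.edge n
  consecutive
    | 0 => h
    | n + 1 => ω.consecutive n

theorem aperiodic_cons {e : Total V} {ω : InfinitePath V} (h : e.right = ω.source)
    (hω : ω.Aperiodic) : (cons e ω h).Aperiodic := by
  rintro ⟨N, p, hp, hN⟩
  refine hω ⟨N, p, hp, fun n hn => ?_⟩
  have := hN (n + 1) (by omega)
  rwa [show n + 1 + p = n + p + 1 by omega] at this

theorem exists_aperiodic_of_path {a b : V} (p : Path a b) (ω : InfinitePath V)
    (hb : ω.source = b) (hω : ω.Aperiodic) : ∃ ω' : InfinitePath V, ω'.source = a ∧ ω'.Aperiodic := by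
  induction p generalizing ω with
  | nil => exact ⟨ω, hb, hω⟩
  | cons p e ih => exact ih (cons ⟨_, _, e⟩ ω hb.symm) rfl (aperiodic_cons _ hω)

end InfinitePath

/-- The indicator sequence of the squares is not eventually periodic. -/
theorem exists_isSquare_not_iff (N p : ℕ) (hp : 0 < p) :
    ∃ n, N ≤ n ∧ ¬ (IsSquare (n + p) ↔ IsSquare n) := by
  -- Adding p to (N + p)² stays strictly below the next square (N + p + 1)².
  refine ⟨(N + p) * (N + p), by nlinarith, fun h => ?_⟩
  obtain ⟨k, hk⟩ := h.2 ⟨_, rfl⟩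
  have h1 : N + p < k := by
    by_contra! hle
    nlinarith [Nat.mul_le_mul hle hle]
  nlinarith [Nat.mul_le_mul h1 h1]

/-- Concatenating the two cycles in the order prescribed by a non-periodic binary sequence works: as
the blocks have equal length, a period of the path would yield a period of the sequence. -/
theorem HasDistinctCycles.exists_aperiodic {y : V} (h : HasDistinctCycles y) :
    ∃ ω : InfinitePath V, ω.source = y ∧ ω.Aperiodic := by
  classical
  obtain ⟨c, d, hcd, hne⟩ := h
  have hL : 0 < c.length := by
    rcases Nat.eq_zero_or_pos c.length with h0 | h0
    · exact absurd ((Path.eq_nil_of_length_zero c h0).trans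
        (Path.eq_nil_of_length_zero d (hcd ▸ h0)).symm) hne
    · exact h0
  set L := c.length with hLdef
  let B : ℕ → Path y y := fun n => if IsSquare n then c else d
  have hB : ∀ n, (B n).edgeList.length = L := by
    intro n
    simp only [B, Path.length_edgeList]
    split_ifs
    · exact hLdef.symm
    · exact hcd.symm
  have hmod : ∀ n, n % L < (B (n / L)).edgeList.length := fun n => by
    rw [hB]; exact Nat.mod_lt _ hL
  let ω : InfinitePath V :=
    { edge := fun n => (B (n / L)).edgeList[n % L]'(hmod n)
      consecutive := fun n => by
        by_cases hn : n % L + 1 < L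
        · have h1 : (n + 1) / L = n / L := by
            rw [Nat.add_div hL, if_neg]
            · rw [Nat.div_eq_of_lt (show 1 < L by omega)]; rfl
            · rw [Nat.mod_eq_of_lt (show 1 < L by omega)]; omega
          have h2 : (n + 1) % L = n % L + 1 := by
            rw [Nat.add_mod, Nat.mod_eq_of_lt (show 1 < L by omega), Nat.mod_eq_of_lt hn]
          have := Path.right_edgeList_eq_left (B (n / L)) (n % L) (by rw [hB]; exact hn)
          simp only [h1, h2]
          exact this
        · have hlt := Nat.mod_lt n hL
          have h2 : (n + 1) % L = 0 := by
            have h3 : n % L + 1 = L := by omega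
            rw [← Nat.mod_add_mod, h3, Nat.mod_self]
          rw [Path.right_edgeList_last (B (n / L)) (n % L) (hmod n) (by
            rw [← Path.length_edgeList, hB]; omega)]
          simp only [h2]
          rw [Path.left_edgeList_zero] }
  refine ⟨ω, Path.left_edgeList_zero _ (by rw [hB]; exact hL), ?_⟩
  rintro ⟨N, p, hp, hN⟩
  -- Multiples of the period p are needed because p may not respect the blocks; L * p does, and
  -- shifts by exactly p blocks.
  have hmul : ∀ k n, N ≤ n → ω.edge (n + k * p) = ω.edge n := by
    intro k
    induction k with
    | zero => intro n _; simp
    | succ k ih =>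
      intro n hn
      rw [show n + (k + 1) * p = (n + k * p) + p by ring, hN _ (by omega), ih n hn]
  obtain ⟨n, hn, hsq⟩ := exists_isSquare_not_iff N p hp
  have hBeq : B (n + p) = B n := by
    apply Path.edgeList_injective
    refine List.ext_getElem (by rw [hB, hB]) fun i h1 h2 => ?_
    rw [hB] at h2
    have h3 := hmul L (n * L + i) (by nlinarith)
    have e1 : (n * L + i + L * p) / L = n + p := by
      rw [show n * L + i + L * p = i + (n + p) * L by ring, Nat.add_mul_div_right _ _ hL,
        Nat.div_eq_of_lt h2, zero_add]
    have e2 : (n * L + i + L * p) % L = i := by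
      rw [show n * L + i + L * p = i + (n + p) * L by ring, Nat.add_mul_mod_self_right,
        Nat.mod_eq_of_lt h2]
    have e3 : (n * L + i) / L = n := by
      rw [show n * L + i = i + n * L by ring, Nat.add_mul_div_right _ _ hL,
        Nat.div_eq_of_lt h2, zero_add]
    have e4 : (n * L + i) % L = i := by
      rw [show n * L + i = i + n * L by ring, Nat.add_mul_mod_self_right,
        Nat.mod_eq_of_lt h2]
    simpa only [ω, e1, e2, e3, e4] using h3
  apply hsq
  simp only [B] at hBeq
  split_ifs at hBeq with h1 h2 h2
  · tauto
  · exact absurd hBeq hne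
  · exact absurd hBeq.symm hne
  · tauto

/-- An aperiodic path which returns to `y` infinitely often runs through distinct closed paths of
the same length at `y`. -/
theorem InfinitePath.Aperiodic.hasDistinctCycles {ω : InfinitePath V} (hω : ω.Aperiodic) {y : V}
    (hy : ∀ N, ∃ n, N ≤ n ∧ ω.vertex n = y) : HasDistinctCycles y := by
  by_contra hD
  obtain ⟨n₀, -, h₀⟩ := hy 0
  obtain ⟨n₁, hn₁, h₁⟩ := hy (n₀ + 1)
  obtain ⟨p, rfl⟩ := Nat.exists_eq_add_of_lt (show n₀ < n₁ by omega)
  refine hω ⟨n₀, p + 1, by omega, fun n hn => ?_⟩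
  obtain ⟨j, rfl⟩ := Nat.exists_eq_add_of_le hn
  -- The return is chosen late enough that the path r, from time n₀ + p + 1 to time m, has more than
  -- j edges.
  obtain ⟨m, hm, h₂⟩ := hy (n₀ + p + 1 + j + 1)
  obtain ⟨k, rfl⟩ := Nat.exists_eq_add_of_le (show n₀ + (p + 1) ≤ m by omega)
  obtain ⟨c, hc⟩ := ω.exists_segment n₀ (p + 1) h₀ h₁
  obtain ⟨r, hr⟩ := ω.exists_segment (n₀ + (p + 1)) k h₁ h₂
  -- If closed paths of equal length coincide, c and r commute. The j-th edge of c r is that of ω at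
  -- time n₀ + j, while the j-th edge of r c is that of ω at time n₀ + p + 1 + j, so p + 1 is a
  -- period.
  have hcr : c.comp r = r.comp c := by
    by_contra hne
    exact hD ⟨_, _, by simp [add_comm], hne⟩
  have hl := congrArg (fun q => (Path.edgeList q)[j]?) hcr
  simp only [Path.edgeList_comp, hc, hr] at hl
  have hlong : (List.range (p + 1)).map (fun i => ω.edge (n₀ + i)) ++
      (List.range k).map (fun i => ω.edge (n₀ + (p + 1) + i)) =
      (List.range (p + 1 + k)).map (fun i => ω.edge (n₀ + i)) := by
    simp [List.range_add, add_assoc]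
  rw [hlong, List.getElem?_append_left (by simp; omega)] at hl
  rw [List.getElem?_eq_getElem (by simp; omega), List.getElem?_eq_getElem (by simp; omega)] at hl
  simp only [List.getElem_map, List.getElem_range, Option.some.injEq] at hl
  rw [hl]
  congr 1
  omega

/-! ### Suffix codes from aperiodic paths -/

/-- The `m`-fold concatenation of a closed path. -/
def Quiver.Path.iterate {y : V} (c : Path y y) : ℕ → Path y y
  | 0 => .nil
  | m + 1 => (c.iterate m).comp c

/-- Read backwards in blocks of the common length, d followed by m copies of c shows exactly m
blocks c before the first block different from c. The arbitrary lists l, l' make this a statement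
about final segments. -/
theorem Quiver.Path.comp_iterate_injective {y : V} (c d : Path y y)
    (hl : c.length = d.length) (hne : c ≠ d) (m m' : ℕ) (l : List (Total V)) (l' : List (Total V))
    (h : l ++ (d.comp (c.iterate m)).edgeList = l' ++ (d.comp (c.iterate m')).edgeList) :
    m = m' := by
  have key : ∀ (k : ℕ) (s s' : List (Total V)),
      s ++ d.edgeList ≠ s' ++ (d.comp (c.iterate (k + 1))).edgeList := by
    intro k s s' hk
    simp only [Path.iterate, Path.edgeList_comp, ← List.append_assoc] at hk
    exact hne (Path.edgeList_injective (List.append_inj' hk (by simp [hl])).2).symm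
  induction m generalizing m' with
  | zero =>
    cases m' with
    | zero => rfl
    | succ k => exact absurd h (by simpa [Path.iterate] using key k l l')
  | succ m ih =>
    cases m' with
    | zero => exact absurd h.symm (by simpa [Path.iterate] using key m l' l)
    | succ k =>
      refine congrArg Nat.succ (ih k ?_)
      simp only [Path.iterate, Path.edgeList_comp, ← List.append_assoc] at h ⊢
      exact (List.append_inj' h rfl).1

/-- From infinite sets indexed by a countable type one can choose distinct elements. -/
theorem exists_injective_mem_of_infinite {ι α : Type*} [Countable ι] (S : ι → Set α)
    (hS : ∀ i, (S i).Infinite) : ∃ f : ι → α, Function.Injective f ∧ ∀ i, f i ∈ S i := by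
  classical
  obtain ⟨n, hn⟩ := exists_injective_nat ι
  choose t ht using fun i => (hS i).exists_subset_card_eq (n i + 1)
  -- Hall's condition: the member of s with the largest n i already contributes n i + 1 ≥ |s|
  -- elements, since n is injective.
  obtain ⟨f, hf, hft⟩ := (Finset.all_card_le_biUnion_card_iff_exists_injective t).1 (by
    intro s
    rcases s.eq_empty_or_nonempty with rfl | hs
    · simp
    obtain ⟨i, hi, hmax⟩ := s.exists_max_image n hs
    calc s.card = (s.image n).card := (Finset.card_image_of_injective s hn).symm
      _ ≤ (Finset.range (n i + 1)).card := Finset.card_le_card fun k hk => by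
        obtain ⟨j, hj, rfl⟩ := Finset.mem_image.1 hk
        exact Finset.mem_range.2 (Nat.lt_succ_of_le (hmax j hj))
      _ = (t i).card := by rw [Finset.card_range, (ht i).2]
      _ ≤ _ := Finset.card_le_card (Finset.subset_biUnion_of_mem t hi))
  exact ⟨f, hf, fun i => (ht i).1 (hft i)⟩

/-- If every vertex is the initial vertex of an aperiodic path, then to the members of a countable
family of vertices one can attach paths of positive length, starting at these vertices, no one of
which is a final segment of another. -/
theorem UniformAperiodicPathProperty.exists_code (hV : UniformAperiodicPathProperty V)
    {ι : Type*} [Countable ι] (s : ι → V) :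
    ∃ (t : ι → V) (q : ∀ i, Path (s i) (t i)), (∀ i, 0 < (q i).length) ∧
      ∀ i j, t i = t j → ∀ l l', l ++ (q i).edgeList = l' ++ (q j).edgeList → i = j := by
  classical
  choose ω hω hap using hV
  obtain ⟨n, hn⟩ := exists_injective_nat ι
  -- For i in A the path is closed off by d and then n i copies of c at a vertex with two distinct
  -- cycles. For i outside A it is cut out of an aperiodic path, with final vertices that differ for
  -- different i.
  let A : Set ι := {i | ∃ y : V, HasDistinctCycles y ∧ Nonempty (Path (s i) y)}
  have hA : ∀ i : A, ∃ (y : V), HasDistinctCycles y ∧ Nonempty (Path (s i) y) := fun i => i.2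
  choose y hy r using hA
  have r : ∀ i : A, Path (s i) (y i) := fun i => (r i).some
  -- An aperiodic path with finitely many vertices returns to one of them infinitely often, which
  -- puts i into A. Time 0 is left out so that the segment chosen later has positive length.
  have hinf : ∀ i : (Aᶜ : Set ι), (Set.range fun k => (ω (s i)).vertex (k + 1)).Infinite := by
    intro i hfin
    have : Finite (Set.range fun k => (ω (s i)).vertex (k + 1)) := hfin
    obtain ⟨⟨z, hz⟩, hz'⟩ := Finite.exists_infinite_fiber
      (Set.rangeFactorization fun k => (ω (s i)).vertex (k + 1))
    have hz' := Set.infinite_coe_iff.1 hz'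
    apply i.2
    have hz'' : ∀ N, ∃ m, N ≤ m ∧ (ω (s i)).vertex m = z := by
      intro N
      obtain ⟨m, hm, hlt⟩ := hz'.exists_gt N
      exact ⟨m + 1, by omega, congrArg Subtype.val hm⟩
    obtain ⟨m, -, hm⟩ := hz'' 0
    refine ⟨z, (hap _).hasDistinctCycles hz'', ?_⟩
    obtain ⟨p, -⟩ := (ω (s i)).exists_segment 0 m (hω (s i)) (b := z) ((congrArg _ (zero_add m)).trans hm)
    exact ⟨p⟩
  obtain ⟨f, hf, hmem⟩ := exists_injective_mem_of_infinite _ hinf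
  choose k hk using hmem
  choose c d hcd hne using fun y : {y : V // HasDistinctCycles y} => y.2
  have hB : ∀ i : (Aᶜ : Set ι), ∃ p : Path (s i) (f i), 0 < p.length := by
    intro i
    obtain ⟨p, hp⟩ := (ω (s i)).exists_segment 0 (k i + 1) (hω (s i)) (b := f i)
      ((congrArg _ (zero_add _)).trans (hk i))
    refine ⟨p, ?_⟩
    rw [← Path.length_edgeList, hp]
    simp
  choose b hb using hB
  have hBy : ∀ i : (Aᶜ : Set ι), ¬ HasDistinctCycles (f i) := fun i h => i.2 ⟨_, h, ⟨b i⟩⟩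
  have hex : ∀ i, ∃ (z : V) (q : Path (s i) z), 0 < q.length ∧
      ((∃ hi : i ∈ A, ∃ hz : HasDistinctCycles z, ∃ p : Path (s i) z,
        q = p.comp ((d ⟨z, hz⟩).comp ((c ⟨z, hz⟩).iterate (n i)))) ∨
      ∃ hi : i ∈ Aᶜ, z = f ⟨i, hi⟩) := by
    intro i
    by_cases hi : i ∈ A
    · refine ⟨y ⟨i, hi⟩, _, ?_, Or.inl ⟨hi, hy ⟨i, hi⟩, r ⟨i, hi⟩, rfl⟩⟩
      have hpos : 0 < (d ⟨_, hy ⟨i, hi⟩⟩).length := by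
        rcases Nat.eq_zero_or_pos (d ⟨_, hy ⟨i, hi⟩⟩).length with h0 | h0
        · exact absurd ((Path.eq_nil_of_length_zero _ ((hcd _).trans h0)).trans
            (Path.eq_nil_of_length_zero _ h0).symm) (hne ⟨_, hy ⟨i, hi⟩⟩)
        · exact h0
      simp only [Path.length_comp]
      omega
    · exact ⟨_, b ⟨i, hi⟩, hb _, Or.inr ⟨hi, rfl⟩⟩
  choose t q hpos hq using hex
  refine ⟨t, q, hpos, fun i j hij l l' h => ?_⟩
  -- The mixed cases are impossible: the final vertex has distinct cycles when the index is in A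
  -- and, by `hBy`, has none otherwise.
  rcases hq i with ⟨hi, hz, p, hp⟩ | ⟨hi, hz⟩ <;> rcases hq j with ⟨hj, hz', p', hp'⟩ | ⟨hj, hz'⟩
  · apply hn
    rw [hp, hp'] at h
    generalize q i = qi at *
    generalize q j = qj at *
    clear hp hp' hpos hq
    generalize t i = ti at *
    generalize t j = tj at *
    subst hij
    rw [Path.edgeList_comp p, Path.edgeList_comp p', ← List.append_assoc, ← List.append_assoc] at h
    exact Path.comp_iterate_injective _ _ (hcd _) (hne _) _ _ _ _ h
  · exact absurd (hij ▸ hz) (hz' ▸ hBy ⟨j, hj⟩)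
  · exact absurd (hij ▸ hz') (hz ▸ hBy ⟨i, hi⟩)
  · exact congrArg Subtype.val (hf (hz.symm.trans (hij.trans hz')))

/-! ### Vertices without aperiodic paths -/

/-- If no aperiodic path starts at `x`, then `x` reaches a vertex `y` to which one can return from
everywhere. -/
theorem exists_terminal_vertex {x : V} (hx : ∀ ω : InfinitePath V, ω.source = x → ¬ ω.Aperiodic) :
    ∃ y, Nonempty (Path x y) ∧ ∀ z, Nonempty (Path y z) → Nonempty (Path z y) := by
  by_contra! h
  -- The infimum of Q y is the distance from y to a vertex of no return. The walk takes the first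
  -- edge of a shortest such path; if the next vertex c can return to y, a vertex with no path back
  -- to y has none to c either, so the distance drops.
  let Q : V → Set ℕ := fun y => {n | ∃ (z : V) (p : Path y z), p.length = n ∧ IsEmpty (Path z y)}
  have step : ∀ y : {y // Nonempty (Path x y)}, ∃ e : Total V, e.left = y ∧
      (Nonempty (Path e.right y) → sInf (Q e.right) < sInf (Q y)) := by
    rintro ⟨y, hy⟩
    obtain ⟨z, ⟨p⟩, hz⟩ := h y hy
    obtain ⟨z, p, hp, hz⟩ := Nat.sInf_mem (s := Q y) ⟨_, z, p, rfl, hz⟩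
    have h0 : p.length ≠ 0 := fun h0 => by
      obtain rfl := Path.eq_of_length_zero p h0
      exact hz.elim .nil
    obtain ⟨c, f, q, rfl, hl⟩ := (Path.length_ne_zero_iff_eq_comp p).1 h0
    refine ⟨⟨y, c, f⟩, rfl, fun ⟨r⟩ => ?_⟩
    rw [← hp, hl]
    exact Nat.lt_succ_of_le (Nat.sInf_le ⟨z, q, rfl, ⟨fun t => hz.elim (t.comp r)⟩⟩)
  choose e he hdesc using step
  have hstep : ∀ y, Nonempty (Path x (e y).right) := fun y =>
    y.2.map fun p => p.cons ((congrArg (· ⟶ (e y).right) (he y)).mp (e y).hom)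
  let s : ℕ → {y // Nonempty (Path x y)} := fun n =>
    Nat.rec ⟨x, ⟨.nil⟩⟩ (fun _ y => ⟨(e y).right, hstep y⟩) n
  let ω : InfinitePath V := ⟨fun n => e (s n), fun n => (he (s (n + 1))).symm⟩
  refine hx ω (he (s 0)) ?_
  rintro ⟨N, p, hp, hN⟩
  have hlt : ∀ n, N ≤ n → sInf (Q (ω.vertex (n + 1))) < sInf (Q (ω.vertex n)) := by
    intro n hn
    have h1 : (e (s n)).right = ω.vertex (n + 1) := ω.consecutive n
    have h2 : (s n).1 = ω.vertex n := (he (s n)).symm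
    have h3 := hdesc (s n)
    rw [h1, h2] at h3
    -- In the periodic range, the p - 1 further edges lead from vertex n + 1 to vertex n + p, which
    -- is vertex n. So returning is always possible and the distance would drop forever.
    obtain ⟨q, -⟩ := ω.exists_segment (n + 1) (p - 1) (b := ω.vertex n) rfl (by
      rw [show n + 1 + (p - 1) = n + p by omega]
      exact congrArg Total.left (hN n hn))
    exact h3 ⟨q⟩
  have hk : ∀ k, sInf (Q (ω.vertex (N + k))) + k ≤ sInf (Q (ω.vertex N)) := by
    intro k
    induction k with
    | zero => exact le_rfl
    | succ k ih =>
      have := hlt (N + k) (by omega)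
      rw [add_assoc] at this
      omega
  have := hk (sInf (Q (ω.vertex N)) + 1)
  omega

/-- Running through the two loops in either order gives closed paths of equal length that differ in
their first edge. -/
theorem hasDistinctCycles_of_ne {a b c : V} (e : a ⟶ b) (f : a ⟶ c) (p : Path b a) (q : Path c a)
    (hne : (⟨a, b, e⟩ : Total V) ≠ ⟨a, c, f⟩) : HasDistinctCycles a := by
  refine ⟨(e.toPath.comp p).comp (f.toPath.comp q), (f.toPath.comp q).comp (e.toPath.comp p),
    by simp only [Path.length_comp]; omega, fun h => hne ?_⟩
  have := congrArg Path.edgeList h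
  simp only [Path.edgeList_comp, Hom.toPath, Path.edgeList_cons, Path.edgeList_nil, List.nil_append,
    List.cons_append, List.cons.injEq] at this
  exact this.1

/-- The edges at the vertices which can be reached from `y` are unique. -/
def IsDeterministic (y : V) : Prop :=
  ∀ z, Nonempty (Path y z) → ∀ e f : Total V, e.left = z → f.left = z → e = f

/-- At a vertex to which everything returns, a branching anywhere ahead would give two distinct
cycles, hence an aperiodic path, which could be prolonged backwards to the given vertex. -/
theorem exists_deterministic_of_not_uniformAperiodicPathProperty
    (h : ¬ UniformAperiodicPathProperty V) :
    ∃ y : V, IsDeterministic y ∧ ∀ z, Nonempty (Path y z) → Nonempty (Path z y) := by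
  unfold UniformAperiodicPathProperty at h
  push Not at h
  obtain ⟨x, hx⟩ := h
  obtain ⟨y, ⟨p⟩, hy⟩ := exists_terminal_vertex (x := x) hx
  refine ⟨y, ?_, hy⟩
  rintro z ⟨q⟩ ⟨a, b, e⟩ ⟨a', c, f⟩ rfl h'
  simp only at h'
  subst h'
  by_contra hne
  obtain ⟨r⟩ := hy b ⟨q.cons e⟩
  obtain ⟨r'⟩ := hy c ⟨q.cons f⟩
  obtain ⟨ω, hω, hap⟩ :=
    (hasDistinctCycles_of_ne e f (r.comp q) (r'.comp q) hne).exists_aperiodic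
  obtain ⟨ω', h1, h2⟩ := InfinitePath.exists_aperiodic_of_path (p.comp q) ω hω hap
  exact hx ω' h1 h2

theorem IsDeterministic.eq_of_length_eq {y z z' : V} (hy : IsDeterministic y) (p : Path y z)
    (q : Path y z') (h : p.length = q.length) : (⟨z, p⟩ : Σ z, Path y z) = ⟨z', q⟩ := by
  induction p generalizing z' with
  | nil =>
    cases q with
    | nil => rfl
    | cons q f => simp at h
  | cons p e ih =>
    cases q with
    | nil => simp at h
    | cons q f =>
      cases ih q (by simpa using h)
      cases hy _ ⟨p⟩ ⟨_, _, e⟩ ⟨_, _, f⟩ rfl rfl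
      rfl

/-- If the edges which can be reached from `y` are unique and one can always return to `y`, then
either the only path from `y` is the trivial one, or there is exactly one path of every length, and
these paths have finitely many final vertices. -/
theorem IsDeterministic.path_dichotomy {y : V} (hy : IsDeterministic y)
    (hret : ∀ z, Nonempty (Path y z) → Nonempty (Path z y)) :
    (∀ w : Σ z, Path y z, w = ⟨y, .nil⟩) ∨
    ∃ w : ℕ → Σ z, Path y z, (∀ n, (w n).2.length = n) ∧ (∀ p : Σ z, Path y z, w p.2.length = p) ∧
      (Set.range fun n => (w n).1).Finite := by
  by_cases hc : ∃ c : Path y y, 0 < c.length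
  · right
    obtain ⟨c, hc⟩ := hc
    have hout : ∀ z, Nonempty (Path y z) → ∃ (z' : V), Nonempty (z ⟶ z') := by
      rintro z ⟨q⟩
      obtain ⟨r⟩ := hret z ⟨q⟩
      obtain ⟨z', e, -⟩ := (Path.length_ne_zero_iff_eq_comp ((r.comp c).comp q)).1 (by
        simp only [Path.length_comp]; omega)
      exact ⟨z', ⟨e⟩⟩
    have hex : ∀ n, ∃ w : Σ z, Path y z, w.2.length = n := by
      intro n
      induction n with
      | zero => exact ⟨⟨y, .nil⟩, rfl⟩
      | succ n ih =>
        obtain ⟨⟨z, w⟩, rfl⟩ := ih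
        obtain ⟨z', ⟨e⟩⟩ := hout z ⟨w⟩
        exact ⟨⟨z', w.cons e⟩, rfl⟩
    choose w hw using hex
    have huniq : ∀ p : Σ z, Path y z, w p.2.length = p := fun p =>
      hy.eq_of_length_eq _ _ (hw _)
    refine ⟨w, hw, huniq, ?_⟩
    -- Inserting the cycle c in front of the path of length n gives the path of length n + |c|, with
    -- the same final vertex.
    have hper : Function.Periodic (fun n => (w n).1) c.length := by
      intro n
      have := huniq ⟨(w n).1, c.comp (w n).2⟩
      simp only [Path.length_comp, hw] at this
      simp only [add_comm n, this]
    classical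
    refine (((Finset.range c.length).image fun n => (w n).1).finite_toSet).subset ?_
    rintro _ ⟨n, rfl⟩
    rw [Finset.mem_coe, Finset.mem_image]
    exact ⟨n % c.length, Finset.mem_range.2 (Nat.mod_lt _ hc), hper.map_mod_nat n⟩
  · left
    rintro ⟨z, w⟩
    obtain ⟨r⟩ := hret z ⟨w⟩
    have h0 : w.length = 0 := by
      by_contra h0
      exact hc ⟨w.comp r, by simp only [Path.length_comp]; omega⟩
    obtain rfl := Path.eq_of_length_zero w h0
    rw [Path.eq_nil_of_length_zero w h0]

/-! ### The standard basis of the Fock space -/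

section FockBasis

theorem fockBasis_apply_self (w : FreeSemigroupoid V) : (fockBasis w : FockSpace V) w = 1 := by
  classical
  rw [fockBasis, lp.coeFn_single, Pi.single_eq_same]

theorem fockBasis_apply_of_ne {w a : FreeSemigroupoid V} (h : a ≠ w) :
    (fockBasis w : FockSpace V) a = 0 := by
  classical
  rw [fockBasis, lp.coeFn_single, Pi.single_eq_of_ne h]

theorem inner_fockBasis (w : FreeSemigroupoid V) (φ : FockSpace V) :
    inner ℂ (fockBasis w) φ = φ w := by
  classical
  rw [fockBasis, lp.inner_single_left]
  simp

theorem orthonormal_fockBasis : Orthonormal ℂ (fockBasis : FreeSemigroupoid V → FockSpace V) := by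
  classical
  rw [orthonormal_iff_ite]
  intro i j
  rw [inner_fockBasis]
  split_ifs with h
  · rw [h, fockBasis_apply_self]
  · exact fockBasis_apply_of_ne h

theorem norm_fockBasis (w : FreeSemigroupoid V) : ‖(fockBasis w : FockSpace V)‖ = 1 :=
  orthonormal_fockBasis.1 w

theorem ext_fockBasis {E : Type*} [NormedAddCommGroup E] [NormedSpace ℂ E]
    {A B : FockSpace V →L[ℂ] E} (h : ∀ w, A (fockBasis w) = B (fockBasis w)) : A = B := by
  classical
  refine lp.ext_continuousLinearMap (by norm_num) fun w => ?_
  ext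
  have := h w
  rw [fockBasis] at this
  simp only [ContinuousLinearMap.comp_apply, lp.singleContinuousLinearMap_apply]
  convert this

/-- The isometry which maps the standard basis to a given orthonormal family. -/
def isometryOfOrthonormal {E : Type*} [NormedAddCommGroup E] [InnerProductSpace ℂ E]
    [CompleteSpace E] {e : FreeSemigroupoid V → E} (he : Orthonormal ℂ e) :
    FockSpace V →ₗᵢ[ℂ] E :=
  he.orthogonalFamily.linearIsometry

@[simp]
theorem isometryOfOrthonormal_fockBasis {E : Type*} [NormedAddCommGroup E] [InnerProductSpace ℂ E]
    [CompleteSpace E] {e : FreeSemigroupoid V → E} (he : Orthonormal ℂ e) (w : FreeSemigroupoid V) :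
    isometryOfOrthonormal he (fockBasis w) = e w := by
  rw [isometryOfOrthonormal, fockBasis, OrthogonalFamily.linearIsometry_apply_single]
  simp

theorem partialShift_fockBasis
    (g : FreeSemigroupoid V → Option (FreeSemigroupoid V))
    (hg : ∀ a b c, g a = some c → g b = some c → a = b) {a w : FreeSemigroupoid V}
    (h : g a = some w) : partialShift g hg (fockBasis w) = fockBasis a := by
  ext u
  rw [partialShift_apply]
  by_cases hu : u = a
  · subst hu
    rw [h, fockBasis_apply_self]
    exact fockBasis_apply_self w
  · rw [fockBasis_apply_of_ne hu]
    rcases hgu : g u with _ | w'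
    · rfl
    · refine fockBasis_apply_of_ne ?_
      rintro rfl
      exact hu (hg _ _ _ hgu h)

theorem partialShift_fockBasis_of_ne
    (g : FreeSemigroupoid V → Option (FreeSemigroupoid V))
    (hg : ∀ a b c, g a = some c → g b = some c → a = b) {w : FreeSemigroupoid V}
    (h : ∀ a, g a ≠ some w) : partialShift g hg (fockBasis w) = 0 := by
  ext u
  rw [partialShift_apply]
  rcases hgu : g u with _ | w'
  · rfl
  · refine fockBasis_apply_of_ne ?_
    rintro rfl
    exact h u hgu

end FockBasis

/-! ### Right translations -/

section RightTranslation

variable {a b : V}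

/-- The paths that begin with the path `w`. -/
def prependPath (w : Path a b) (v : Σ c, Path b c) : FreeSemigroupoid V := ⟨a, v.1, w.comp v.2⟩

theorem prependPath_injective (w : Path a b) : Function.Injective (prependPath w) := by
  rintro ⟨c, p⟩ ⟨c', p'⟩ h
  simp only [prependPath, Sigma.mk.injEq, heq_eq_eq, true_and] at h
  obtain ⟨rfl, h⟩ := h
  rw [Path.comp_injective_right w (eq_of_heq h)]

open Classical in
/-- Removal of the initial segment `w` from a path that begins with `w`. -/
def removeInitial (w : Path a b) (u : FreeSemigroupoid V) : Option (FreeSemigroupoid V) :=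
  if h : ∃ v, prependPath w v = u then some ⟨b, h.choose⟩ else none

theorem removeInitial_prependPath (w : Path a b) (v : Σ c, Path b c) :
    removeInitial w (prependPath w v) = some ⟨b, v⟩ := by
  have h : ∃ v', prependPath w v' = prependPath w v := ⟨v, rfl⟩
  rw [removeInitial, dif_pos h, prependPath_injective w h.choose_spec]

theorem removeInitial_eq_some {w : Path a b} {u v : FreeSemigroupoid V}
    (h : removeInitial w u = some v) : ∃ v' : Σ c, Path b c, v = ⟨b, v'⟩ ∧ u = prependPath w v' := by
  rw [removeInitial] at h
  split_ifs at h with h'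
  exact ⟨_, (Option.some.inj h).symm, h'.choose_spec.symm⟩

theorem removeInitial_injective (w : Path a b) (u₁ u₂ v : FreeSemigroupoid V)
    (h₁ : removeInitial w u₁ = some v) (h₂ : removeInitial w u₂ = some v) : u₁ = u₂ := by
  obtain ⟨v₁, rfl, rfl⟩ := removeInitial_eq_some h₁
  obtain ⟨v₂, h, rfl⟩ := removeInitial_eq_some h₂
  cases h
  rfl

/-- The operator `R_w`: it maps `ξ_v` to `ξ_{vw}`, where `vw` runs first through `w`, if `v` starts
at the final vertex of `w`, and to `0` otherwise. -/
def rightPath (w : Path a b) : FockSpace V →L[ℂ] FockSpace V :=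
  partialShift (removeInitial w) (removeInitial_injective w)

theorem rightPath_fockBasis (w : Path a b) {c : V} (v : Path b c) :
    rightPath w (fockBasis ⟨b, c, v⟩) = fockBasis ⟨a, c, w.comp v⟩ :=
  partialShift_fockBasis _ _ (removeInitial_prependPath w ⟨c, v⟩)

theorem rightPath_fockBasis_of_ne (w : Path a b) (v : FreeSemigroupoid V) (hv : v.1 ≠ b) :
    rightPath w (fockBasis v) = 0 :=
  partialShift_fockBasis_of_ne _ _ fun u hu => by
    obtain ⟨v', rfl, -⟩ := removeInitial_eq_some hu
    exact hv rfl

theorem rightPath_apply_comp (w : Path a b) {c : V} (v : Path b c) (φ : FockSpace V) :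
    rightPath w φ ⟨a, c, w.comp v⟩ = φ ⟨b, c, v⟩ := by
  have h := removeInitial_prependPath w ⟨c, v⟩
  rw [prependPath] at h
  rw [rightPath, partialShift_apply, h]
  rfl

theorem rightPath_nil_apply_of_ne (a : V) (u : FreeSemigroupoid V) (hu : u.1 ≠ a)
    (φ : FockSpace V) : rightPath (Path.nil : Path a a) φ u = 0 := by
  rw [rightPath, partialShift_apply]
  rcases h : removeInitial (Path.nil : Path a a) u with _ | v
  · rfl
  · obtain ⟨v', rfl, rfl⟩ := removeInitial_eq_some h
    exact absurd rfl hu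

theorem leftEdge_commute_rightPath (w : Path a b) (e : Total V) :
    Commute (leftEdge e) (rightPath w) := by
  refine ext_fockBasis fun v => ?_
  obtain ⟨c, d, v⟩ := v
  simp only [mul_apply_eq_comp]
  by_cases hv : c = b
  · subst hv
    rw [rightPath_fockBasis]
    by_cases he : d = e.left
    · obtain ⟨x, y, e⟩ := e
      subst he
      rw [leftEdge_fockBasis, leftEdge_fockBasis, rightPath_fockBasis, Path.comp_cons]
    · rw [leftEdge_fockBasis_of_ne _ _ he, leftEdge_fockBasis_of_ne _ _ he, map_zero]
  · rw [rightPath_fockBasis_of_ne _ _ hv, map_zero]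
    by_cases he : d = e.left
    · obtain ⟨x, y, e⟩ := e
      subst he
      rw [leftEdge_fockBasis, rightPath_fockBasis_of_ne _ _ hv]
    · rw [leftEdge_fockBasis_of_ne _ _ he, map_zero]

theorem leftVertex_commute_rightPath (w : Path a b) (x : V) :
    Commute (leftVertex x) (rightPath w) := by
  refine ext_fockBasis fun v => ?_
  obtain ⟨c, d, v⟩ := v
  simp only [mul_apply_eq_comp]
  by_cases hv : c = b
  · subst hv
    rw [rightPath_fockBasis]
    by_cases he : d = x
    · rw [leftVertex_fockBasis _ _ he, leftVertex_fockBasis _ _ he, rightPath_fockBasis]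
    · rw [leftVertex_fockBasis_of_ne _ _ he, leftVertex_fockBasis_of_ne _ _ he, map_zero]
  · rw [rightPath_fockBasis_of_ne _ _ hv, map_zero]
    by_cases he : d = x
    · rw [leftVertex_fockBasis _ _ he, rightPath_fockBasis_of_ne _ _ hv]
    · rw [leftVertex_fockBasis_of_ne _ _ he, map_zero]

end RightTranslation

/-! ### The free semigroupoid algebra -/

section Algebra

/-- Multiplication is separately WOT-continuous, so the commutant of R is WOT-closed. -/
theorem commute_of_mem_wotClosure {H : Type*} [NormedAddCommGroup H] [InnerProductSpace ℂ H]
    {A : NonUnitalSubalgebra ℂ (H →L[ℂ] H)} {R T : H →L[ℂ] H} (hA : ∀ S ∈ A, Commute S R)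
    (hT : T ∈ wotClosure A) : Commute T R := by
  have hclosed : IsClosed {X : H →WOT[ℂ] H | X * .ofCLM R = .ofCLM R * X} :=
    isClosed_eq (continuous_mul_const _) (continuous_const_mul _)
  have := closure_minimal (s := ContinuousLinearMapWOT.ofCLM '' (A : Set (H →L[ℂ] H))) (by
    rintro _ ⟨S, hS, rfl⟩
    exact congrArg ContinuousLinearMapWOT.ofCLM (hA S hS).eq) hclosed hT
  exact congrArg ContinuousLinearMapWOT.toCLM this

theorem commute_of_mem_adjoin {A : Type*} [NonUnitalRing A] [Module ℂ A] [IsScalarTower ℂ A A]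
    [SMulCommClass ℂ A A] {s : Set A} {R T : A} (hs : ∀ S ∈ s, Commute S R)
    (hT : T ∈ NonUnitalAlgebra.adjoin ℂ s) : Commute T R := by
  induction hT using NonUnitalAlgebra.adjoin_induction with
  | mem S hS => exact hs S hS
  | add S T _ _ hS hT => exact hS.add_left hT
  | zero => exact Commute.zero_left _
  | mul S T _ _ hS hT => exact hS.mul_left hT
  | smul c S _ hS => exact hS.smul_left c

theorem commute_rightPath_of_mem {T : FockSpace V →L[ℂ] FockSpace V}
    (hT : T ∈ freeSemigroupoidAlgebra V) {a b : V} (w : Path a b) : Commute T (rightPath w) := by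
  refine commute_of_mem_wotClosure (fun S hS => commute_of_mem_adjoin ?_ hS) hT
  rintro _ (⟨e, rfl⟩ | ⟨x, rfl⟩)
  · exact leftEdge_commute_rightPath w e
  · exact leftVertex_commute_rightPath w x

variable {T : FockSpace V →L[ℂ] FockSpace V}

/-- ξ_w is the right translate of the vacuum vector at the final vertex of w, and T commutes with
right translations; so T is determined by its values at the vertices. -/
theorem apply_fockBasis_comp_of_mem (hT : T ∈ freeSemigroupoidAlgebra V) {a b c : V} (w : Path a b)
    (v : Path b c) :
    T (fockBasis ⟨a, b, w⟩) ⟨a, c, w.comp v⟩ = T (fockBasis ⟨b, b, .nil⟩) ⟨b, c, v⟩ := by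
  have h1 : fockBasis ⟨a, b, w⟩ = rightPath w (fockBasis ⟨b, b, .nil⟩) := by
    rw [rightPath_fockBasis, Path.comp_nil]
  have h2 := DFunLike.congr_fun (commute_rightPath_of_mem hT w).eq (fockBasis ⟨b, b, .nil⟩)
  simp only [mul_apply_eq_comp] at h2
  rw [h1, h2, rightPath_apply_comp]

/-- Right translation by the trivial path at a is the projection onto the paths that start at a. -/
theorem apply_fockBasis_nil_eq_zero_of_mem (hT : T ∈ freeSemigroupoidAlgebra V) (a : V)
    (u : FreeSemigroupoid V) (hu : u.1 ≠ a) : T (fockBasis ⟨a, a, .nil⟩) u = 0 := by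
  have h2 := DFunLike.congr_fun (commute_rightPath_of_mem hT (.nil : Path a a)).eq
    (fockBasis ⟨a, a, .nil⟩)
  simp only [mul_apply_eq_comp, rightPath_fockBasis, Path.comp_nil] at h2
  rw [h2, rightPath_nil_apply_of_ne _ _ hu]

theorem exists_finset_sum_norm_sq_gt {φ : FockSpace V} (hφ : ‖φ‖ = 1) {r : ℝ} (hr : r < 1) :
    ∃ A : Finset (FreeSemigroupoid V), ∀ B, A ⊆ B → r < ∑ a ∈ B, ‖φ a‖ ^ 2 := by
  have h := lp.norm_rpow_eq_tsum (p := 2) (by norm_num) φ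
  have hs := (lp.memℓp φ).summable (p := 2) (by norm_num)
  simp only [ENNReal.toReal_ofNat, Real.rpow_two] at h hs
  rw [hφ, one_pow] at h
  have := (hs.hasSum.eventually (lt_mem_nhds (h ▸ hr)))
  exact eventually_atTop.1 this

end Algebra

/-! ### Isometries with orthogonal ranges need aperiodic paths -/

theorem orthonormal_sum_elim_of_isometry {H ι : Type*} [NormedAddCommGroup H]
    [InnerProductSpace ℂ H] [CompleteSpace H] {S T : H →L[ℂ] H} (hS : Isometry S) (hT : Isometry T)
    (hST : ContinuousLinearMap.adjoint S ∘L T = 0) {e : ι → H} (he : Orthonormal ℂ e) :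
    Orthonormal ℂ (Sum.elim (fun i => S (e i)) (fun i => T (e i))) := by
  classical
  have hST' : ∀ x y, inner ℂ (S x) (T y) = 0 := fun x y => by
    rw [← ContinuousLinearMap.adjoint_inner_right]
    have := DFunLike.congr_fun hST y
    simp only [ContinuousLinearMap.comp_apply, zero_apply] at this
    rw [this, inner_zero_right]
  have hS' : ∀ x y, inner ℂ (S x) (S y) = inner ℂ x y :=
    LinearIsometry.inner_map_map ⟨S.toLinearMap, fun x => by
      simpa using hS.norm_map_of_map_zero (map_zero S) x⟩
  have hT' : ∀ x y, inner ℂ (T x) (T y) = inner ℂ x y :=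
    LinearIsometry.inner_map_map ⟨T.toLinearMap, fun x => by
      simpa using hT.norm_map_of_map_zero (map_zero T) x⟩
  rw [orthonormal_iff_ite] at he ⊢
  rintro (i | i) (j | j)
  · simp [hS', he]
  · simp [hST']
  · simp only [Sum.elim_inr, Sum.elim_inl, reduceCtorEq, if_false]
    rw [← inner_conj_symm, hST', map_zero]
  · simp [hT', he]

/-- The images of `k` basis vectors under two isometries with orthogonal ranges have, summed up over
`n` coordinates, at most the weight `n`. -/
theorem sum_norm_sq_le_of_isometry {S T : FockSpace V →L[ℂ] FockSpace V} (hS : Isometry S)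
    (hT : Isometry T) (hST : ContinuousLinearMap.adjoint S ∘L T = 0) {w : ℕ → FreeSemigroupoid V}
    (hw : Function.Injective w) (k n : ℕ) :
    ∑ j ∈ Finset.range k, (∑ m ∈ Finset.range n, ‖S (fockBasis (w j)) (w m)‖ ^ 2 +
      ∑ m ∈ Finset.range n, ‖T (fockBasis (w j)) (w m)‖ ^ 2) ≤ n := by
  have ho := orthonormal_sum_elim_of_isometry hS hT hST (orthonormal_fockBasis.comp w hw)
  have h1 : ∀ m, ∑ j ∈ Finset.range k, (‖S (fockBasis (w j)) (w m)‖ ^ 2 +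
      ‖T (fockBasis (w j)) (w m)‖ ^ 2) ≤ 1 := by
    intro m
    have := ho.sum_inner_products_le (s := (Finset.range k).disjSum (Finset.range k))
      (fockBasis (w m))
    rw [Finset.sum_disjSum, norm_fockBasis, one_pow, ← Finset.sum_add_distrib] at this
    simpa only [Sum.elim_inl, Sum.elim_inr, Function.comp_apply, norm_inner_symm _ (fockBasis (w m)),
      inner_fockBasis] using this
  calc _ = ∑ m ∈ Finset.range n, ∑ j ∈ Finset.range k, (‖S (fockBasis (w j)) (w m)‖ ^ 2 +
      ‖T (fockBasis (w j)) (w m)‖ ^ 2) := by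
        rw [Finset.sum_comm]
        simp_rw [Finset.sum_add_distrib]
    _ ≤ ∑ m ∈ Finset.range n, 1 := Finset.sum_le_sum fun m _ => h1 m
    _ = n := by simp

/-- Prolonging w_j by v gives the unique path of length j + |v|. Thus the coefficients at the vertex
reappear, without overlap, as coefficients of T ξ_{w_j} at the paths w_m. -/
theorem sum_norm_sq_le_of_unique_paths {T : FockSpace V →L[ℂ] FockSpace V}
    (hT : T ∈ freeSemigroupoidAlgebra V) {y : V} {w : ℕ → Σ z, Path y z}
    (hlen : ∀ n, (w n).2.length = n) (hw : ∀ p : Σ z, Path y z, w p.2.length = p) (j n : ℕ)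
    (A : Finset (FreeSemigroupoid V)) (hA : ∀ a ∈ A, j + a.2.2.length < n) :
    ∑ a ∈ A, ‖T (fockBasis ⟨(w j).1, (w j).1, .nil⟩) a‖ ^ 2 ≤
      ∑ m ∈ Finset.range n, ‖T (fockBasis ⟨y, w j⟩) ⟨y, w m⟩‖ ^ 2 := by
  classical
  have hstart : ∀ a ∈ A, ‖T (fockBasis ⟨(w j).1, (w j).1, .nil⟩) a‖ ^ 2 ≠ 0 → a.1 = (w j).1 := by
    intro a _ h
    by_contra hne
    rw [apply_fockBasis_nil_eq_zero_of_mem hT _ _ hne] at h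
    simp at h
  rw [← Finset.sum_filter_of_ne hstart]
  have hcomp : ∀ (c : V) (v : Path (w j).1 c), w (j + v.length) = ⟨c, (w j).2.comp v⟩ := by
    intro c v
    have := hw ⟨c, (w j).2.comp v⟩
    rwa [Path.length_comp, hlen] at this
  have hterm : ∀ a ∈ A.filter (fun a => a.1 = (w j).1),
      ‖T (fockBasis ⟨(w j).1, (w j).1, .nil⟩) a‖ ^ 2 =
        ‖T (fockBasis ⟨y, w j⟩) ⟨y, w (j + a.2.2.length)⟩‖ ^ 2 := by
    rintro ⟨b, c, v⟩ ha
    obtain rfl : b = (w j).1 := (Finset.mem_filter.1 ha).2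
    rw [hcomp, ← apply_fockBasis_comp_of_mem hT (w j).2 v]
  rw [Finset.sum_congr rfl hterm]
  have hinj : Set.InjOn (fun a : FreeSemigroupoid V => j + a.2.2.length)
      (A.filter (fun a => a.1 = (w j).1)) := by
    rintro ⟨b, c, v⟩ ha ⟨b', c', v'⟩ ha' h
    obtain rfl : b = (w j).1 := (Finset.mem_filter.1 ha).2
    obtain rfl : b' = (w j).1 := (Finset.mem_filter.1 ha').2
    have h1 := (hcomp c v).symm.trans ((congrArg w h).trans (hcomp c' v'))
    exact congrArg (Sigma.mk (w j).1) (prependPath_injective (w j).2 (a₁ := ⟨c, v⟩) (a₂ := ⟨c', v'⟩)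
      (congrArg (Sigma.mk y) h1))
  rw [← Finset.sum_image (f := fun m => ‖T (fockBasis ⟨y, w j⟩) ⟨y, w m⟩‖ ^ 2) hinj]
  refine Finset.sum_le_sum_of_subset_of_nonneg ?_ fun _ _ _ => by positivity
  intro m hm
  obtain ⟨a, ha, rfl⟩ := Finset.mem_image.1 hm
  exact Finset.mem_range.2 (hA a (Finset.mem_filter.1 ha).1)

theorem uniformAperiodicPathProperty_of_isometries {S T : FockSpace V →L[ℂ] FockSpace V}
    (hS : S ∈ freeSemigroupoidAlgebra V) (hT : T ∈ freeSemigroupoidAlgebra V)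
    (hSi : Isometry S) (hTi : Isometry T) (hST : ContinuousLinearMap.adjoint S ∘L T = 0) :
    UniformAperiodicPathProperty V := by
  classical
  by_contra hV
  obtain ⟨y, hdet, hret⟩ := exists_deterministic_of_not_uniformAperiodicPathProperty hV
  -- Any threshold above 1/2 would serve: what matters is that the two weights together exceed 1.
  have hA : ∀ z : V, ∃ A : Finset (FreeSemigroupoid V),
      3 / 4 < ∑ a ∈ A, ‖S (fockBasis ⟨z, z, .nil⟩) a‖ ^ 2 ∧
      3 / 4 < ∑ a ∈ A, ‖T (fockBasis ⟨z, z, .nil⟩) a‖ ^ 2 := by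
    intro z
    obtain ⟨A, hA⟩ := exists_finset_sum_norm_sq_gt (φ := S (fockBasis ⟨z, z, .nil⟩))
      ((hSi.norm_map_of_map_zero (map_zero S) _).trans (norm_fockBasis _))
      (show (3 / 4 : ℝ) < 1 by norm_num)
    obtain ⟨B, hB⟩ := exists_finset_sum_norm_sq_gt (φ := T (fockBasis ⟨z, z, .nil⟩))
      ((hTi.norm_map_of_map_zero (map_zero T) _).trans (norm_fockBasis _))
      (show (3 / 4 : ℝ) < 1 by norm_num)
    exact ⟨A ∪ B, hA _ Finset.subset_union_left, hB _ Finset.subset_union_right⟩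
  choose A hA using hA
  rcases hdet.path_dichotomy hret with hw | ⟨w, hlen, hw, hfin⟩
  · have ho := orthonormal_sum_elim_of_isometry hSi hTi hST orthonormal_fockBasis
    have h1 := ho.sum_inner_products_le (fockBasis ⟨y, y, .nil⟩)
      (s := {.inl ⟨y, y, .nil⟩, .inr ⟨y, y, .nil⟩})
    rw [Finset.sum_pair (by simp), norm_fockBasis, one_pow] at h1
    simp only [Sum.elim_inl, Sum.elim_inr, norm_inner_symm _ (fockBasis _), inner_fockBasis] at h1
    -- With only the trivial path at y, both images of ξ_y are multiples of ξ_y, which cannot be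
    -- orthogonal unit vectors.
    have h2 : ∀ R ∈ freeSemigroupoidAlgebra V, ∑ a ∈ A y, ‖R (fockBasis ⟨y, y, .nil⟩) a‖ ^ 2 ≤
        ‖R (fockBasis ⟨y, y, .nil⟩) ⟨y, y, .nil⟩‖ ^ 2 := by
      intro R hR
      rw [← Finset.sum_singleton (fun a => ‖R (fockBasis ⟨y, y, .nil⟩) a‖ ^ 2) ⟨y, y, .nil⟩]
      rw [← Finset.sum_filter_ne_zero]
      refine Finset.sum_le_sum_of_subset_of_nonneg ?_ fun _ _ _ => by positivity
      rintro ⟨b, c, v⟩ ha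
      replace ha := (Finset.mem_filter.1 ha).2
      by_cases hb : b = y
      · subst hb
        rw [hw ⟨c, v⟩]
        exact Finset.mem_singleton_self _
      · rw [apply_fockBasis_nil_eq_zero_of_mem hR _ _ hb] at ha
        simp at ha
    linarith [h2 S hS, h2 T hT, (hA y).1, (hA y).2]
  · set M := (hfin.toFinset.biUnion A).sup fun a => a.2.2.length with hM
    have hwi : Function.Injective fun n => (⟨y, w n⟩ : FreeSemigroupoid V) := by
      intro m n h
      simp only [Sigma.mk.injEq, heq_eq_eq, true_and] at h
      rw [← hlen m, h, hlen]
    -- The images of the first k vectors keep weight at least 3k/2 on the first k + M coordinates,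
    -- so a contradiction needs k > 2M; k = 3M + 1 is such a choice.
    have h1 := sum_norm_sq_le_of_isometry hSi hTi hST hwi (3 * M + 1) (4 * M + 1)
    have hlt : ∀ j ∈ Finset.range (3 * M + 1), ∀ a ∈ A (w j).1, j + a.2.2.length < 4 * M + 1 := by
      intro j hj a ha
      have h3 : a.2.2.length ≤ M := Finset.le_sup (f := fun a : FreeSemigroupoid V => a.2.2.length)
        (Finset.mem_biUnion.2 ⟨(w j).1, hfin.mem_toFinset.2 ⟨j, rfl⟩, ha⟩)
      have := Finset.mem_range.1 hj
      omega
    have h2 : ∑ j ∈ Finset.range (3 * M + 1), (3 / 2 : ℝ) ≤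
        ∑ j ∈ Finset.range (3 * M + 1),
          (∑ m ∈ Finset.range (4 * M + 1), ‖S (fockBasis ⟨y, w j⟩) ⟨y, w m⟩‖ ^ 2 +
            ∑ m ∈ Finset.range (4 * M + 1), ‖T (fockBasis ⟨y, w j⟩) ⟨y, w m⟩‖ ^ 2) := by
      refine Finset.sum_le_sum fun j hj => ?_
      linarith [sum_norm_sq_le_of_unique_paths hS hlen hw j _ _ (hlt j hj),
        sum_norm_sq_le_of_unique_paths hT hlen hw j _ _ (hlt j hj), (hA (w j).1).1, (hA (w j).1).2]
    have h3 := h2.trans h1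
    simp only [Finset.sum_const, Finset.card_range, nsmul_eq_mul] at h3
    push_cast at h3
    nlinarith [(Nat.cast_nonneg M : (0 : ℝ) ≤ M)]

/-! ### Amplifications -/

section Amplification

variable {H K C : Type*} [NormedAddCommGroup H] [InnerProductSpace ℂ H]
  [NormedAddCommGroup K] [InnerProductSpace ℂ K] [CompleteSpace K]
  {J : C → H →ₗᵢ[ℂ] K} (hJ : IsHilbertSum ℂ (fun _ : C => H) J)

namespace IsHilbertSum

/-- If `K` is a direct sum of copies of `H`, then `T` acts on `K` as the direct sum of copies
of `T`. -/
def amplify (T : H →L[ℂ] H) : K →L[ℂ] K :=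
  (hJ.linearIsometryEquiv.symm.toContinuousLinearEquiv : lp (fun _ : C => H) 2 →L[ℂ] K) ∘L
    lp.mapCLM 2 (fun _ : C => T) (norm_nonneg T) (fun _ => le_rfl) ∘L
      (hJ.linearIsometryEquiv.toContinuousLinearEquiv : K →L[ℂ] lp (fun _ : C => H) 2)

theorem linearIsometryEquiv_amplify (T : H →L[ℂ] H) (x : K) (k : C) :
    hJ.linearIsometryEquiv (hJ.amplify T x) k = T (hJ.linearIsometryEquiv x k) := by
  simp [amplify]

theorem ext_coordinates {x y : K}
    (h : ∀ k, hJ.linearIsometryEquiv x k = hJ.linearIsometryEquiv y k) : x = y :=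
  hJ.linearIsometryEquiv.injective (lp.ext (funext h))

theorem inner_eq_tsum_coordinates (x y : K) :
    inner ℂ x y = ∑' k, inner ℂ (hJ.linearIsometryEquiv x k) (hJ.linearIsometryEquiv y k) := by
  rw [← hJ.linearIsometryEquiv.inner_map_map, lp.inner_eq_tsum]

theorem linearIsometryEquiv_apply [DecidableEq C] (k : C) (x : H) :
    hJ.linearIsometryEquiv (J k x) = lp.single 2 k x := by
  rw [← hJ.linearIsometryEquiv_symm_apply_single, LinearIsometryEquiv.apply_symm_apply]

theorem amplify_apply (T : H →L[ℂ] H) (k : C) (x : H) : hJ.amplify T (J k x) = J k (T x) := by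
  classical
  refine hJ.ext_coordinates fun l => ?_
  rw [linearIsometryEquiv_amplify, linearIsometryEquiv_apply, linearIsometryEquiv_apply]
  by_cases h : l = k
  · subst h; simp
  · rw [lp.single_apply_ne _ _ _ h, lp.single_apply_ne _ _ _ h, map_zero]

theorem eq_of_inner_eq (hJ : IsHilbertSum ℂ (fun _ : C => H) J) {x y : K}
    (h : ∀ k z, inner ℂ (J k z) x = inner ℂ (J k z) y) : x = y := by
  classical
  refine hJ.ext_coordinates fun k => ext_inner_left ℂ fun z => ?_
  have := h k z
  rw [← hJ.linearIsometryEquiv.inner_map_map, ← hJ.linearIsometryEquiv.inner_map_map (J k z),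
    linearIsometryEquiv_apply, lp.inner_single_left, lp.inner_single_left] at this
  exact this

theorem summable_norm_mul_coordinates (x y : K) :
    Summable fun k => ‖hJ.linearIsometryEquiv x k‖ * ‖hJ.linearIsometryEquiv y k‖ := by
  have hs : ∀ z : K, Summable fun k => ‖hJ.linearIsometryEquiv z k‖ ^ 2 := fun z => by
    simpa using (lp.memℓp (hJ.linearIsometryEquiv z)).summable (p := 2) (by norm_num)
  refine Summable.of_nonneg_of_le (fun _ => by positivity) (fun k => ?_) ((hs x).add (hs y))
  nlinarith [two_mul_le_add_sq ‖hJ.linearIsometryEquiv x k‖ ‖hJ.linearIsometryEquiv y k‖,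
    norm_nonneg (hJ.linearIsometryEquiv x k), norm_nonneg (hJ.linearIsometryEquiv y k),
    mul_nonneg (norm_nonneg (hJ.linearIsometryEquiv x k)) (norm_nonneg (hJ.linearIsometryEquiv y k))]

theorem ext_operator (hJ : IsHilbertSum ℂ (fun _ : C => H) J) {E : Type*} [NormedAddCommGroup E] [InnerProductSpace ℂ E]
    [CompleteSpace E] {A B : K →L[ℂ] E} (h : ∀ k z, A (J k z) = B (J k z)) : A = B := by
  have : ContinuousLinearMap.adjoint A = ContinuousLinearMap.adjoint B := by
    ext x
    refine hJ.eq_of_inner_eq fun k z => ?_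
    rw [ContinuousLinearMap.adjoint_inner_right, ContinuousLinearMap.adjoint_inner_right, h]
  exact ContinuousLinearMap.adjoint.injective this

theorem amplify_injective [Nonempty C] : Function.Injective hJ.amplify := by
  intro S T h
  obtain ⟨k⟩ := ‹Nonempty C›
  ext x
  apply (J k).injective
  rw [← hJ.amplify_apply, h, hJ.amplify_apply]

variable [CompleteSpace H]

/-- The amplification as a `*`-homomorphism. -/
def amplifyHom : (H →L[ℂ] H) →⋆ₐ[ℂ] (K →L[ℂ] K) where
  toFun := hJ.amplify
  map_one' := by
    ext x
    exact hJ.ext_coordinates fun k => by simp [linearIsometryEquiv_amplify]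
  map_mul' S T := by
    ext x
    exact hJ.ext_coordinates fun k => by simp [linearIsometryEquiv_amplify]
  map_zero' := by
    ext x
    exact hJ.ext_coordinates fun k => by simp [linearIsometryEquiv_amplify]
  map_add' S T := by
    ext x
    exact hJ.ext_coordinates fun k => by simp [linearIsometryEquiv_amplify]
  commutes' c := by
    ext x
    exact hJ.ext_coordinates fun k => by
      simp [linearIsometryEquiv_amplify, Algebra.algebraMap_eq_smul_one]
  map_star' T := by
    rw [ContinuousLinearMap.star_eq_adjoint, ContinuousLinearMap.star_eq_adjoint,
      ContinuousLinearMap.eq_adjoint_iff]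
    intro x y
    simp [hJ.inner_eq_tsum_coordinates, linearIsometryEquiv_amplify,
      ContinuousLinearMap.adjoint_inner_left]

@[simp]
theorem amplifyHom_apply (T : H →L[ℂ] H) : hJ.amplifyHom T = hJ.amplify T := rfl

/-- The amplification is block diagonal with T in every diagonal block, so commuting with it can be
tested on each block of A. -/
theorem commute_amplify_iff (A : K →L[ℂ] K) (T : H →L[ℂ] H) :
    Commute A (hJ.amplify T) ↔ ∀ k l,
      Commute (ContinuousLinearMap.adjoint (J k).toContinuousLinearMap ∘L A ∘L
        (J l).toContinuousLinearMap) T := by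
  have key : ∀ (k : C) (x : H) (y : K), inner ℂ (J k x) (hJ.amplify T y) =
      inner ℂ (J k (ContinuousLinearMap.adjoint T x)) y := by
    intro k x y
    rw [← ContinuousLinearMap.adjoint_inner_left, ← hJ.amplify_apply]
    have := hJ.amplifyHom.map_star' T
    rw [ContinuousLinearMap.star_eq_adjoint, ContinuousLinearMap.star_eq_adjoint] at this
    exact congrArg (fun B : K →L[ℂ] K => inner ℂ (B (J k x)) y) this.symm
  have hadj : ∀ (k : C) (x : H) (y : K),
      inner ℂ x (ContinuousLinearMap.adjoint (J k).toContinuousLinearMap y) = inner ℂ (J k x) y :=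
    fun k x y => ContinuousLinearMap.adjoint_inner_right _ _ _
  constructor
  · intro h k l
    ext x
    refine ext_inner_left ℂ fun y => ?_
    have h1 := DFunLike.congr_fun h.eq (J l x)
    simp only [mul_apply_eq_comp, hJ.amplify_apply] at h1
    simp only [mul_apply_eq_comp, ContinuousLinearMap.comp_apply]
    rw [hadj, ← ContinuousLinearMap.adjoint_inner_left T, hadj, ← key]
    exact congrArg (inner ℂ (J k y)) h1
  · intro h
    refine hJ.ext_operator fun l x => hJ.eq_of_inner_eq fun k y => ?_
    have h1 := DFunLike.congr_fun (h k l).eq x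
    simp only [mul_apply_eq_comp, ContinuousLinearMap.comp_apply] at h1
    simp only [mul_apply_eq_comp, hJ.amplify_apply]
    rw [key, ← hadj, ← hadj, ContinuousLinearMap.adjoint_inner_left]
    exact congrArg (inner ℂ y) h1

/-- By the double commutant description it suffices that operators commuting with `t` and its
adjoints commute with the amplification of T; their blocks commute with `s` and its adjoints, hence
with T. -/
theorem amplify_mem_generatedVonNeumannAlgebra {s : Set (H →L[ℂ] H)} {t : Set (K →L[ℂ] K)}
    (hst : ∀ S ∈ s, hJ.amplify S ∈ generatedVonNeumannAlgebra t) {T : H →L[ℂ] H}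
    (hT : T ∈ generatedVonNeumannAlgebra s) : hJ.amplify T ∈ generatedVonNeumannAlgebra t := by
  have hcomm : ∀ A ∈ StarSubalgebra.centralizer ℂ t, Commute A (hJ.amplify T) := by
    intro A hA
    rw [commute_amplify_iff]
    intro k l
    refine ((StarSubalgebra.mem_centralizer_iff ℂ).1 hT _ ?_).1
    rw [SetLike.mem_coe, StarSubalgebra.mem_centralizer_iff]
    intro S hS
    have h1 := (StarSubalgebra.mem_centralizer_iff ℂ).1 (hst S hS) A hA
    have h2 := (StarSubalgebra.mem_centralizer_iff ℂ).1 (star_mem (hst S hS)) A hA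
    refine ⟨(((hJ.commute_amplify_iff A S).1 h1.1) k l).symm.eq, ?_⟩
    rw [← hJ.amplifyHom_apply, ← map_star, hJ.amplifyHom_apply] at h2
    exact (((hJ.commute_amplify_iff A (star S)).1 h2.1) k l).symm.eq
  change hJ.amplify T ∈ StarSubalgebra.centralizer ℂ (StarSubalgebra.centralizer ℂ t : Set _)
  rw [StarSubalgebra.mem_centralizer_iff]
  exact fun A hA => ⟨(hcomm A hA).eq, (hcomm _ (star_mem hA)).eq⟩

/-- The hypothesis on I says S I = I (`amplify` S) on every summand, so amplification agrees on the
closure of A with the compression S ↦ I* S I, which is WOT-continuous without any bound on norms. -/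
theorem amplify_mem_wotClosure {A : NonUnitalSubalgebra ℂ (H →L[ℂ] H)}
    {B : NonUnitalSubalgebra ℂ (K →L[ℂ] K)} (hAB : ∀ S ∈ A, hJ.amplify S ∈ wotClosure B)
    (I : K →ₗᵢ[ℂ] H)
    (hI : ∀ T ∈ wotClosure A, ∀ k, Commute T (I.toContinuousLinearMap ∘L (J k).toContinuousLinearMap))
    {T : H →L[ℂ] H} (hT : T ∈ wotClosure A) : hJ.amplify T ∈ wotClosure B := by
  have hII : ContinuousLinearMap.adjoint I.toContinuousLinearMap ∘L I.toContinuousLinearMap = 1 := by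
    ext x
    refine ext_inner_left ℂ fun y => ?_
    rw [ContinuousLinearMap.comp_apply, ContinuousLinearMap.adjoint_inner_right]
    exact I.inner_map_map y x
  have hint : ∀ S ∈ wotClosure A, hJ.amplify S =
      ContinuousLinearMap.adjoint I.toContinuousLinearMap ∘L S ∘L I.toContinuousLinearMap := by
    intro S hS
    have : S ∘L I.toContinuousLinearMap = I.toContinuousLinearMap ∘L hJ.amplify S := by
      refine hJ.ext_operator fun k z => ?_
      simpa [hJ.amplify_apply] using DFunLike.congr_fun (hI S hS k).eq z
    rw [this, ← ContinuousLinearMap.comp_assoc, hII]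
    rfl
  have hcont : Continuous fun X : H →WOT[ℂ] H =>
      (ContinuousLinearMapWOT.ofCLM (ContinuousLinearMap.adjoint I.toContinuousLinearMap)).comp
        (X.comp (ContinuousLinearMapWOT.ofCLM I.toContinuousLinearMap)) :=
    (ContinuousLinearMapWOT.continuous_postcomp _).comp
      (ContinuousLinearMapWOT.continuous_precomp _)
  have h1 := map_mem_closure hcont (show ContinuousLinearMapWOT.ofCLM T ∈ _ from hT)
    (t := closure (ContinuousLinearMapWOT.ofCLM '' (B : Set (K →L[ℂ] K)))) (by
      rintro _ ⟨S, hS, rfl⟩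
      have h2 := hAB S hS
      rw [hint S (subset_closure ⟨S, hS, rfl⟩)] at h2
      exact h2)
  rw [closure_closure] at h1
  rw [hint T hT]
  exact h1

/-- Matrix coefficients of the amplification are infinite sums of matrix coefficients; the norm
bound supplies the majorant for dominated convergence. -/
theorem tendsto_amplify {ι : Type*} {l : Filter ι} {S : ι → H →L[ℂ] H} {T : H →L[ℂ] H} {r : ℝ}
    (hr : ∀ᶠ i in l, ‖S i‖ ≤ r)
    (hS : Tendsto (fun i => ContinuousLinearMapWOT.ofCLM (S i)) l
      (𝓝 (ContinuousLinearMapWOT.ofCLM T))) :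
    Tendsto (fun i => ContinuousLinearMapWOT.ofCLM (hJ.amplify (S i))) l
      (𝓝 (ContinuousLinearMapWOT.ofCLM (hJ.amplify T))) := by
  rw [ContinuousLinearMapWOT.tendsto_iff_forall_inner_apply_tendsto] at hS ⊢
  intro x y
  simp only [ContinuousLinearMapWOT.ofCLM_apply, hJ.inner_eq_tsum_coordinates,
    linearIsometryEquiv_amplify] at hS ⊢
  refine tendsto_tsum_of_dominated_convergence
    (bound := fun k => r * (‖hJ.linearIsometryEquiv y k‖ * ‖hJ.linearIsometryEquiv x k‖))
    ((hJ.summable_norm_mul_coordinates y x).mul_left r) (fun k => hS _ _) ?_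
  filter_upwards [hr] with i hi k
  calc _ ≤ ‖hJ.linearIsometryEquiv y k‖ * ‖S i (hJ.linearIsometryEquiv x k)‖ :=
        norm_inner_le_norm _ _
    _ ≤ ‖hJ.linearIsometryEquiv y k‖ * (r * ‖hJ.linearIsometryEquiv x k‖) := by
        gcongr
        exact (S i).le_of_opNorm_le hi _
    _ = _ := by ring

end IsHilbertSum

end Amplification

/-! ### Infinite sums of left translations -/

theorem generator_mem_freeSemigroupoidAlgebra {T : FockSpace V →L[ℂ] FockSpace V}
    (hT : T ∈ NonUnitalAlgebra.adjoin ℂ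
      (Set.range (leftEdge (V := V)) ∪ Set.range (leftVertex (V := V)))) :
    T ∈ freeSemigroupoidAlgebra V :=
  subset_closure ⟨T, hT, rfl⟩

theorem exists_leftPath {a b : V} (p : Path a b) :
    ∃ L ∈ NonUnitalAlgebra.adjoin ℂ
      (Set.range (leftEdge (V := V)) ∪ Set.range (leftVertex (V := V))),
      (∀ (c : V) (w : Path c a), L (fockBasis ⟨c, a, w⟩) = fockBasis ⟨c, b, w.comp p⟩) ∧
      ∀ w : FreeSemigroupoid V, w.2.1 ≠ a → L (fockBasis w) = 0 := by
  induction p with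
  | nil =>
    exact ⟨leftVertex a, NonUnitalAlgebra.subset_adjoin ℂ (Or.inr ⟨a, rfl⟩),
      fun c w => leftVertex_fockBasis _ _ rfl, fun w hw => leftVertex_fockBasis_of_ne _ _ hw⟩
  | @cons b c p e ih =>
    obtain ⟨L, hL, h1, h2⟩ := ih
    refine ⟨leftEdge ⟨b, c, e⟩ * L,
      mul_mem (NonUnitalAlgebra.subset_adjoin ℂ (Or.inl ⟨_, rfl⟩)) hL, fun d w => ?_, fun w hw => ?_⟩
    · rw [mul_apply_eq_comp, h1, leftEdge_fockBasis, Path.comp_cons]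
    · rw [mul_apply_eq_comp, h2 w hw, map_zero]

theorem leftVertex_apply_of_eq (x : V) (φ : FockSpace V) (a : FreeSemigroupoid V) (h : a.2.1 = x) :
    leftVertex x φ a = φ a := by
  rw [leftVertex, partialShift_apply, if_pos h]
  rfl

theorem leftVertex_apply_of_ne (x : V) (φ : FockSpace V) (a : FreeSemigroupoid V) (h : a.2.1 ≠ x) :
    leftVertex x φ a = 0 := by
  rw [leftVertex, partialShift_apply, if_neg h]
  rfl

/-- The projections `L_x` sum up to the identity. -/
theorem tendsto_sum_leftVertex :
    Tendsto (fun F : Finset V => ContinuousLinearMapWOT.ofCLM (∑ x ∈ F, leftVertex x)) atTop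
      (𝓝 (ContinuousLinearMapWOT.ofCLM (1 : FockSpace V →L[ℂ] FockSpace V))) := by
  rw [ContinuousLinearMapWOT.tendsto_iff_forall_inner_apply_tendsto]
  intro φ ψ
  simp only [ContinuousLinearMapWOT.ofCLM_apply, sum_apply, inner_sum]
  have h := (lp.hasSum_inner (𝕜 := ℂ) ψ φ).tsum_fiberwise fun a => a.2.1
  have h' : HasSum (fun x => inner ℂ ψ (leftVertex x φ)) (inner ℂ ψ φ) := by
    refine (congrArg (HasSum · (inner ℂ ψ φ)) (funext fun x => ?_)).mpr h
    rw [lp.inner_eq_tsum, tsum_subtype ((fun a : FreeSemigroupoid V => a.2.1) ⁻¹' {x})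
      (fun a => inner ℂ (ψ a) (φ a))]
    refine tsum_congr fun a => ?_
    by_cases ha : a.2.1 = x
    · rw [leftVertex_apply_of_eq _ _ _ ha, Set.indicator_of_mem (by simpa using ha)]
    · rw [leftVertex_apply_of_ne _ _ _ ha, Set.indicator_of_notMem (by simpa using ha),
        inner_zero_right]
  exact h'

/-- Cutting down by L_x leaves the left translation by the single path q x, a product of generators;
U is the WOT-limit of the finite sums of these pieces. -/
theorem mem_freeSemigroupoidAlgebra_of_fockBasis {U : FockSpace V →L[ℂ] FockSpace V} (t : V → V)
    (q : ∀ x, Path x (t x))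
    (hU : ∀ (a b : V) (w : Path a b), U (fockBasis ⟨a, b, w⟩) = fockBasis ⟨a, t b, w.comp (q b)⟩) :
    U ∈ freeSemigroupoidAlgebra V := by
  have h1 : ∀ x, U * leftVertex x ∈ NonUnitalAlgebra.adjoin ℂ
      (Set.range (leftEdge (V := V)) ∪ Set.range (leftVertex (V := V))) := by
    intro x
    obtain ⟨L, hL, h1, h2⟩ := exists_leftPath (q x)
    convert hL
    refine ext_fockBasis fun w => ?_
    rw [mul_apply_eq_comp]
    obtain ⟨a, b, w⟩ := w
    by_cases hb : b = x
    · subst hb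
      rw [leftVertex_fockBasis b ⟨a, b, w⟩ rfl, hU, h1]
    · rw [leftVertex_fockBasis_of_ne _ _ hb, map_zero, h2 _ hb]
  have h2 := ((continuous_const_mul (ContinuousLinearMapWOT.ofCLM U)).tendsto _).comp
    (tendsto_sum_leftVertex (V := V))
  refine mem_closure_of_tendsto (b := atTop) (by simpa using h2) (Eventually.of_forall fun F => ?_)
  refine ⟨∑ x ∈ F, U * leftVertex x, sum_mem fun x _ => h1 x, ?_⟩
  rw [← Finset.mul_sum]
  rfl

/-! ### The graph with one vertex and two loops -/

section TwoLoops

/-- The two loops. -/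
def loop (i : Fin 2) : Total (SingleObj (Fin 2)) := ⟨SingleObj.star _, SingleObj.star _, i⟩

/-- The path `w` followed by the loop `i`. -/
def consLoop (i : Fin 2) (w : FreeSemigroupoid (SingleObj (Fin 2))) :
    FreeSemigroupoid (SingleObj (Fin 2)) :=
  ⟨w.1, SingleObj.star _, w.2.2.cons i⟩

theorem leftEdge_loop_fockBasis (i : Fin 2) (w : FreeSemigroupoid (SingleObj (Fin 2))) :
    leftEdge (loop i) (fockBasis w) = fockBasis (consLoop i w) :=
  leftEdge_fockBasis (V := SingleObj (Fin 2)) w.2.2 i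

theorem consLoop_injective {i j : Fin 2} {w w' : FreeSemigroupoid (SingleObj (Fin 2))}
    (h : consLoop i w = consLoop j w') : i = j ∧ w = w' := by
  obtain ⟨a, b, w⟩ := w
  obtain ⟨a', b', w'⟩ := w'
  cases h
  exact ⟨rfl, rfl⟩

theorem leftEdge_eq_loop (e : Total (SingleObj (Fin 2))) : ∃ i, e = loop i := ⟨e.hom, rfl⟩

theorem leftVertex_singleObj (x : SingleObj (Fin 2)) :
    (leftVertex x : FockSpace (SingleObj (Fin 2)) →L[ℂ] _) = 1 :=
  ext_fockBasis fun w => leftVertex_fockBasis x w rfl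

theorem adjoint_leftEdge_loop (i j : Fin 2) :
    ContinuousLinearMap.adjoint (leftEdge (loop i)) ∘L leftEdge (loop j) = if i = j then 1 else 0 := by
  refine ext_fockBasis fun w => lp.ext (funext fun u => ?_)
  rw [← inner_fockBasis, ← inner_fockBasis, ContinuousLinearMap.comp_apply,
    ContinuousLinearMap.adjoint_inner_right, leftEdge_loop_fockBasis, leftEdge_loop_fockBasis]
  by_cases hij : i = j
  · subst hij
    rw [if_pos rfl]
    change _ = inner ℂ (fockBasis u) (fockBasis w)
    classical
    rw [orthonormal_iff_ite.1 orthonormal_fockBasis, orthonormal_iff_ite.1 orthonormal_fockBasis]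
    congr 1
    exact propext ⟨fun h => (consLoop_injective h).2, fun h => h ▸ rfl⟩
  · rw [if_neg hij, zero_apply, inner_zero_right]
    exact orthonormal_fockBasis.2 fun h => hij (consLoop_injective h).1

theorem loop_mem (i : Fin 2) : leftEdge (loop i) ∈ freeSemigroupAlgebraTwo :=
  generator_mem_freeSemigroupoidAlgebra (NonUnitalAlgebra.subset_adjoin ℂ (Or.inl ⟨_, rfl⟩))

end TwoLoops

/-- The relations L_i* L_j = δ_ij live in the generated von Neumann algebra and survive under the
unital `*`-homomorphism. -/
theorem UnitallyPartlyFree.exists_isometries {H : Type*} [NormedAddCommGroup H]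
    [InnerProductSpace ℂ H] [CompleteSpace H] {A : NonUnitalSubalgebra ℂ (H →L[ℂ] H)}
    (hA : UnitallyPartlyFree A) :
    ∃ S T : H →L[ℂ] H, S ∈ A ∧ T ∈ A ∧ Isometry S ∧ Isometry T ∧
      ContinuousLinearMap.adjoint S ∘L T = 0 := by
  obtain ⟨Φ, -, -, hΦ⟩ := hA
  let L : Fin 2 → (generatedVonNeumannAlgebra
      (freeSemigroupAlgebraTwo : Set (FockSpace (SingleObj (Fin 2)) →L[ℂ] _))).toStarSubalgebra :=
    fun i => ⟨leftEdge (loop i), subset_generatedVonNeumannAlgebra _ (loop_mem i)⟩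
  have hL : ∀ i j, star (L i) * L j = if i = j then 1 else 0 := by
    intro i j
    apply Subtype.ext
    refine (adjoint_leftEdge_loop i j).trans ?_
    split_ifs <;> rfl
  have hΦL : ∀ i j, ContinuousLinearMap.adjoint (Φ (L i)).1 ∘L (Φ (L j)).1 =
      if i = j then 1 else 0 := by
    intro i j
    have h := congrArg (fun T => (Φ T).1) (hL i j)
    simp only [map_mul, map_star] at h
    refine Eq.trans h ?_
    split_ifs
    · rw [map_one]; rfl
    · rw [map_zero]; rfl
  have hiso : ∀ i, Isometry (Φ (L i)).1 := by
    intro i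
    refine AddMonoidHomClass.isometry_of_norm _ fun x => ?_
    have := DFunLike.congr_fun (hΦL i i) x
    rw [if_pos rfl] at this
    have h2 := ContinuousLinearMap.apply_norm_sq_eq_inner_adjoint_right (Φ (L i)).1 x
    rw [this] at h2
    have h3 : ‖(Φ (L i)).1 x‖ ^ 2 = ‖x‖ ^ 2 := by
      rw [h2, ← inner_self_eq_norm_sq (𝕜 := ℂ) x]; rfl
    exact (sq_eq_sq₀ (norm_nonneg _) (norm_nonneg _)).1 h3
  exact ⟨_, _, hΦ (L 0) (loop_mem 0), hΦ (L 1) (loop_mem 1), hiso 0, hiso 1, by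
    rw [hΦL, if_neg (by decide)]⟩

/-! ### Factorization along two maps -/

section Factorization

variable {X : Type*} (σ : Fin 2 → X → X)

/-- Applies the maps `σ 0` and `σ 1` to `x` as prescribed by a word in the two loops. -/
def applyWord (x : X) {a : SingleObj (Fin 2)} : ∀ {b : SingleObj (Fin 2)}, Path a b → X
  | _, .nil => x
  | _, .cons p e => σ e (applyWord x p)

variable {σ}

/-- The outermost map is recognizable from its value, so letters can be peeled off until one of the
starting points, which lie in neither range, is reached. -/
theorem applyWord_injective (hσ : ∀ i j x y, σ i x = σ j y → i = j ∧ x = y) {x x' : X}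
    (hx : ∀ i y, σ i y ≠ x) (hx' : ∀ i y, σ i y ≠ x') {a b a' b' : SingleObj (Fin 2)}
    (p : Path a b) (p' : Path a' b') (h : applyWord σ x p = applyWord σ x' p') :
    (⟨a, b, p⟩ : FreeSemigroupoid (SingleObj (Fin 2))) = ⟨a', b', p'⟩ ∧ x = x' := by
  induction p generalizing b' with
  | nil =>
    cases p' with
    | nil =>
      obtain rfl : a = a' := SingleObj.ext
      exact ⟨rfl, h⟩
    | cons p' e => exact absurd h.symm (hx _ _)
  | cons p e ih =>
    cases p' with
    | nil => exact absurd h (hx' _ _)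
    | cons p' e' =>
      obtain ⟨he, h⟩ := hσ _ _ _ _ h
      obtain ⟨h1, h2⟩ := ih p' h
      refine ⟨?_, h2⟩
      cases h1
      exact congrArg (fun f => consLoop f ⟨_, _, p⟩) he

theorem exists_applyWord_eq {l : X → ℕ} (hl : ∀ i x, l x < l (σ i x)) (x : X) :
    ∃ k : {k // ∀ i y, σ i y ≠ k}, ∃ w : FreeSemigroupoid (SingleObj (Fin 2)),
      applyWord σ k.1 w.2.2 = x := by
  induction hn : l x using Nat.strong_induction_on generalizing x with
  | _ n ih =>
    by_cases hx : ∀ i y, σ i y ≠ x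
    · exact ⟨⟨x, hx⟩, ⟨SingleObj.star _, _, .nil⟩, rfl⟩
    · push Not at hx
      obtain ⟨i, y, rfl⟩ := hx
      obtain ⟨k, w, hw⟩ := ih (l y) (hn ▸ hl i y) y rfl
      exact ⟨k, consLoop i w, congrArg (σ i) hw⟩

/-- If the maps `σ 0` and `σ 1` are injective with disjoint ranges and increase a rank, then every
element arises in a unique way from an element outside of their ranges. -/
def wordEquiv (hσ : ∀ i j x y, σ i x = σ j y → i = j ∧ x = y) {l : X → ℕ}
    (hl : ∀ i x, l x < l (σ i x)) :
    FreeSemigroupoid (SingleObj (Fin 2)) × {k // ∀ i y, σ i y ≠ k} ≃ X :=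
  Equiv.ofBijective (fun p => applyWord σ p.2.1 p.1.2.2) (by
    constructor
    · rintro ⟨w, k⟩ ⟨w', k'⟩ h
      obtain ⟨h1, h2⟩ := applyWord_injective hσ k.2 k'.2 _ _ h
      exact Prod.ext h1 (Subtype.ext h2)
    · intro x
      obtain ⟨k, w, h⟩ := exists_applyWord_eq hl x
      exact ⟨(w, k), h⟩)

theorem wordEquiv_consLoop (hσ : ∀ i j x y, σ i x = σ j y → i = j ∧ x = y) {l : X → ℕ}
    (hl : ∀ i x, l x < l (σ i x)) (i : Fin 2) (w : FreeSemigroupoid (SingleObj (Fin 2)))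
    (k : {k // ∀ i y, σ i y ≠ k}) :
    wordEquiv hσ hl (consLoop i w, k) = σ i (wordEquiv hσ hl (w, k)) := rfl

end Factorization

/-! ### Decompositions of Fock spaces -/

section Decomposition

variable {V' : Type*} [Quiver V'] {C : Type*}
  (b : FreeSemigroupoid V' × C ≃ FreeSemigroupoid V)

/-- The embedding of a Fock space into another one as the summand with index `k`. -/
def blockIsometry (k : C) : FockSpace V' →ₗᵢ[ℂ] FockSpace V :=
  isometryOfOrthonormal (orthonormal_fockBasis.comp (fun w => b (w, k))
    (b.injective.comp (Prod.mk_left_injective k)))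

theorem blockIsometry_fockBasis (k : C) (w : FreeSemigroupoid V') :
    blockIsometry b k (fockBasis w) = fockBasis (b (w, k)) :=
  isometryOfOrthonormal_fockBasis _ w

/-- The blocks partition the standard basis: different blocks are orthogonal, and a vector
orthogonal to all of them has only zero coordinates. -/
theorem isHilbertSum_blockIsometry :
    IsHilbertSum ℂ (fun _ : C => FockSpace V') (blockIsometry b) := by
  refine IsHilbertSum.mk ?_ ?_
  · intro k l hkl x y
    have h : ContinuousLinearMap.adjoint (blockIsometry b k).toContinuousLinearMap ∘L
        (blockIsometry b l).toContinuousLinearMap = 0 := by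
      refine ext_fockBasis fun w => lp.ext (funext fun u => ?_)
      rw [← inner_fockBasis, ContinuousLinearMap.comp_apply,
        ContinuousLinearMap.adjoint_inner_right]
      simp only [LinearIsometry.coe_toContinuousLinearMap, blockIsometry_fockBasis]
      exact orthonormal_fockBasis.2 fun h => hkl (congrArg Prod.snd (b.injective h))
    have h1 := ContinuousLinearMap.adjoint_inner_right (blockIsometry b k).toContinuousLinearMap x
      (blockIsometry b l y)
    have h2 : ContinuousLinearMap.adjoint (blockIsometry b k).toContinuousLinearMap
      (blockIsometry b l y) = 0 := DFunLike.congr_fun h y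
    rw [h2, inner_zero_right] at h1
    exact h1.symm
  · rw [top_le_iff, Submodule.topologicalClosure_eq_top_iff, Submodule.eq_bot_iff]
    intro φ hφ
    refine lp.ext (funext fun a => ?_)
    obtain ⟨⟨w, k⟩, rfl⟩ := b.surjective a
    rw [← inner_fockBasis, ← blockIsometry_fockBasis]
    exact (Submodule.mem_orthogonal _ _).1 hφ _ (Submodule.mem_iSup_of_mem k ⟨_, rfl⟩)

end Decomposition

/-! ### A prefix code for the free semigroup -/

/-- The word which consists of `n` times the loop `0` and then the loop `1`. -/
def prefixWord (n : ℕ) : Path (SingleObj.star (Fin 2)) (SingleObj.star (Fin 2)) :=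
  ((Path.nil.cons (0 : Fin 2)).iterate n).cons (1 : Fin 2)

theorem edgeList_prefixWord (n : ℕ) :
    (prefixWord n).edgeList = List.replicate n (loop 0) ++ [loop 1] := by
  have : ∀ m, ((Path.nil.cons (0 : Fin 2) : Path (SingleObj.star (Fin 2)) _).iterate m).edgeList =
      List.replicate m (loop 0) := by
    intro m
    induction m with
    | zero => rfl
    | succ m ih =>
      rw [Path.iterate, Path.edgeList_comp, ih, List.replicate_succ']
      rfl
  rw [prefixWord, Path.edgeList_cons, this]
  rfl

theorem replicate_append_cons_injective {α : Type*} {a b : α} (hab : a ≠ b) {m n : ℕ}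
    {l l' : List α} (h : List.replicate m a ++ b :: l = List.replicate n a ++ b :: l') :
    m = n ∧ l = l' := by
  induction m generalizing n with
  | zero =>
    cases n with
    | zero => exact ⟨rfl, by simpa using h⟩
    | succ n => simp [List.replicate_succ, hab.symm] at h
  | succ m ih =>
    cases n with
    | zero => simp [List.replicate_succ, hab] at h
    | succ n =>
      simp only [List.replicate_succ, List.cons_append, List.cons.injEq, true_and] at h
      obtain ⟨h1, h2⟩ := ih h
      exact ⟨congrArg _ h1, h2⟩

/-- The first occurrence of the loop 1 marks where the initial word ends, so these words form an
infinite prefix code. -/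
theorem prependPath_prefixWord_injective {m n : ℕ}
    {v v' : Σ c, Path (SingleObj.star (Fin 2)) c}
    (h : prependPath (prefixWord m) v = prependPath (prefixWord n) v') : m = n ∧ v = v' := by
  have h1 := congrArg (fun w : FreeSemigroupoid (SingleObj (Fin 2)) => w.2.2.edgeList) h
  simp only [prependPath, Path.edgeList_comp, edgeList_prefixWord, List.append_assoc,
    List.singleton_append] at h1
  have hne : loop 0 ≠ loop 1 := fun h => by
    have h2 : (0 : Fin 2) = 1 := congrArg (fun e : Total (SingleObj (Fin 2)) => (e.hom : Fin 2)) h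
    exact absurd h2 (by decide)
  obtain ⟨h2, h3⟩ := replicate_append_cons_injective hne h1
  exact ⟨h2, Path.sigma_eq_of_edgeList_eq _ _ h3⟩

/-! ### Partly free algebras from aperiodic paths -/

theorem UniformAperiodicPathProperty.unitallyPartlyFree [Nonempty V] [Countable V]
    [∀ a b : V, Countable (a ⟶ b)] (hV : UniformAperiodicPathProperty V) :
    UnitallyPartlyFree (freeSemigroupoidAlgebra V) := by
  obtain ⟨t, q, hpos, hcode⟩ := hV.exists_code (ι := V × Fin 2) Prod.fst
  let σ : Fin 2 → FreeSemigroupoid V → FreeSemigroupoid V :=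
    fun i w => ⟨w.1, t (w.2.1, i), w.2.2.comp (q (w.2.1, i))⟩
  have hσ : ∀ i j x y, σ i x = σ j y → i = j ∧ x = y := by
    rintro i j ⟨a, b, w⟩ ⟨a', b', w'⟩ h
    have h1 : t (b, i) = t (b', j) := congrArg (fun w => w.2.1) h
    have h2 := congrArg (fun w => w.2.2.edgeList) h
    simp only [σ, Path.edgeList_comp] at h2
    obtain ⟨rfl, rfl⟩ := Prod.mk.inj (hcode _ _ h1 _ _ h2)
    simp only [σ, Sigma.mk.injEq] at h
    obtain ⟨rfl, h⟩ := h
    simp only [heq_eq_eq, Sigma.mk.injEq, true_and] at h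
    exact ⟨rfl, by rw [Path.comp_injective_left _ h]⟩
  have hl : ∀ i x, x.2.2.length < (σ i x).2.2.length := by
    intro i x
    have := hpos (x.2.1, i)
    simp only [σ, Path.length_comp]
    omega
  let b := wordEquiv hσ (l := fun x => x.2.2.length) hl
  have hJ := isHilbertSum_blockIsometry b
  have hgen : ∀ S ∈ NonUnitalAlgebra.adjoin ℂ (Set.range (leftEdge (V := SingleObj (Fin 2))) ∪
      Set.range (leftVertex (V := SingleObj (Fin 2)))),
      hJ.amplify S ∈ freeSemigroupoidAlgebra V := by
    intro S hS
    change S ∈ (freeSemigroupoidAlgebra V).comap hJ.amplifyHom.toNonUnitalAlgHom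
    refine NonUnitalAlgebra.adjoin_le ?_ hS
    rintro _ (⟨e, rfl⟩ | ⟨x, rfl⟩)
    · obtain ⟨i, rfl⟩ := leftEdge_eq_loop e
      refine mem_freeSemigroupoidAlgebra_of_fockBasis (U := hJ.amplify (leftEdge (loop i)))
        (fun x => t (x, i)) (fun x => q (x, i)) fun a c w => ?_
      obtain ⟨⟨w', k⟩, hw⟩ := b.surjective ⟨a, c, w⟩
      rw [← hw, ← blockIsometry_fockBasis, hJ.amplify_apply, leftEdge_loop_fockBasis,
        blockIsometry_fockBasis, wordEquiv_consLoop]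
      exact congrArg (fun x => fockBasis (σ i x)) hw
    · rw [leftVertex_singleObj]
      have h1 : hJ.amplify 1 = 1 := map_one hJ.amplifyHom
      refine mem_freeSemigroupoidAlgebra_of_fockBasis (U := hJ.amplify 1) (fun x => x)
        (fun x => .nil) fun a c w => ?_
      rw [h1]
      rfl
  -- Trivial paths lie in neither range, as both maps increase the length. At least one summand is
  -- needed for injectivity of the amplification.
  have : Nonempty {k // ∀ i y, σ i y ≠ k} := by
    obtain ⟨x⟩ := ‹Nonempty V›
    refine ⟨⟨x, x, .nil⟩, fun i y h => ?_⟩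
    have := hl i y
    rw [h] at this
    simp at this
  -- The summands are countably many because the graph is countable, so the prefix code has enough
  -- words to label them.
  obtain ⟨n, hn⟩ := exists_injective_nat {k // ∀ i y, σ i y ≠ k}
  let g : FreeSemigroupoid V → FreeSemigroupoid (SingleObj (Fin 2)) := fun a =>
    prependPath (prefixWord (n (b.symm a).2)) (b.symm a).1.2
  have hg : Function.Injective g := by
    intro x y h
    obtain ⟨h1, h2⟩ := prependPath_prefixWord_injective h
    refine b.symm.injective (Prod.ext ?_ (hn h1))
    exact congrArg (Sigma.mk (SingleObj.star (Fin 2))) h2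
  let I : FockSpace V →ₗᵢ[ℂ] FockSpace (SingleObj (Fin 2)) :=
    isometryOfOrthonormal (orthonormal_fockBasis.comp g hg)
  -- On the k-th summand the embedding I is a right translation, and right translations commute with
  -- the free semigroup algebra.
  have hIJ : ∀ k, I.toContinuousLinearMap ∘L (blockIsometry b k).toContinuousLinearMap =
      rightPath (prefixWord (n k)) := by
    intro k
    refine ext_fockBasis fun w => ?_
    simp only [ContinuousLinearMap.comp_apply, LinearIsometry.coe_toContinuousLinearMap,
      blockIsometry_fockBasis, I, isometryOfOrthonormal_fockBasis, Function.comp_apply, g]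
    rw [Equiv.symm_apply_apply]
    exact (rightPath_fockBasis (prefixWord (n k)) w.2.2).symm
  have hmem : ∀ T ∈ freeSemigroupAlgebraTwo, hJ.amplify T ∈ freeSemigroupoidAlgebra V :=
    fun T hT => hJ.amplify_mem_wotClosure hgen I (fun S hS k => by
      rw [hIJ]
      exact commute_rightPath_of_mem hS _) hT
  refine ⟨(hJ.amplifyHom.comp (StarSubalgebra.subtype _)).codRestrict _ fun T =>
    hJ.amplify_mem_generatedVonNeumannAlgebra
      (fun S hS => subset_generatedVonNeumannAlgebra _ (hmem S hS)) T.2, ?_, ?_, ?_⟩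
  · intro S T h
    exact Subtype.ext (hJ.amplify_injective (congrArg Subtype.val h))
  · intro r l T hr hT
    exact hJ.tendsto_amplify hr hT
  · exact fun T hT => hmem T.1 hT

end

theorem theorem2p6 (V : Type u) [Quiver.{v} V] [Nonempty V] [Countable V]
    [∀ a b : V, Countable (a ⟶ b)] :
    List.TFAE [
      UniformAperiodicPathProperty V,
      UnitallyPartlyFree (freeSemigroupoidAlgebra V),
      ∃ S T : FockSpace V →L[ℂ] FockSpace V,
        S ∈ freeSemigroupoidAlgebra V ∧
        T ∈ freeSemigroupoidAlgebra V ∧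
        Isometry S ∧ Isometry T ∧ ContinuousLinearMap.adjoint S ∘L T = 0] := by
  tfae_have 1 → 2 := fun h => h.unitallyPartlyFree
  tfae_have 2 → 3 := fun h => h.exists_isometries
  tfae_have 3 → 1 := fun ⟨_, _, hS, hT, hSi, hTi, h⟩ =>
    uniformAperiodicPathProperty_of_isometries hS hT hSi hTi h
  tfae_finish
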